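/- **Theorem (Optimal scaling for the QuanTA swap move).** Let $f=e^{-H}:\mathbb R\to(0,\infty)$ be $C^4$ and unimodal with maximum at $\mu$ (nondecreasing on $(-\infty,\mu]$, nonincreasing on $[\mu,\infty)$). Suppose that $H=-\log f$ is regularly varying, i.e. there is $\alpha>0$ with $H(tx)/H(t)\to x^\alpha$ as $|t|\to\infty$ for every $x>0$, and that $|(\log f)''''|<M$ on $\mathbb R$ for some $M>0$. For $d\ge1$ let $f_d(x)=\prod_{i=1}^d f(x_i)$, let $\beta>0$, $\epsilon>0$, $\beta'=\beta+\epsilon$, and let $x,y\in\mathbb R^d$ be independent with densities proportional to $f_d^{\beta}$ and $f_d^{\beta'}$. With $g(x,\beta,\beta')=(\beta/\beta')^{1/2}(x-\mu\mathbf 1)+\mu\mathbf 1$, where $\mathbf 1=(1,\dots,1)$, the QuanTA swap is accepted with probability $$\alpha_\beta(x,y)=\min\Big(1,\frac{f_d^{\beta'}(g(x,\beta,\beta'))\,f_d^{\beta}(g(y,\beta',\beta))}{f_d^{\beta'}(y)\,f_d^{\beta}(x)}\Big).$$ Put $\gamma=\beta'$ if the swap is accepted and $\gamma=\beta$ otherwise,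 and let $\mathrm{ESJD}_\beta=\mathbb E[(\gamma-\beta)^2]=\epsilon^2\,\mathbb E[\alpha_\beta(x,y)]$. With subscript $\beta$ referring to the law on $\mathbb R$ with density proportional to $f^\beta$, let $$V(\beta)=\mathrm{Cov}_\beta\big(\log f,(x-\mu)(\log f)'\big),\quad I(\beta)=\mathrm{Var}_\beta(\log f),\quad R(\beta)=\mathbb E_\beta\big[(x-\mu)^2(\log f)''-(x-\mu)(\log f)'\big],$$ $$J(\beta)=I(\beta)-\tfrac12V(\beta)-\tfrac1{4\beta}R(\beta).$$ Then, for every $\beta>0$, these moments are well defined, $V(\beta)=1/\beta^2$, $J(\beta)\ge0$, and the following hold. 1. If $\epsilon=\ell/d^{1/2}$ with $\ell>0$, then, with $\Phi$ the standard normal distribution function, $$\lim_{d\to\infty}d\,\mathrm{ESJD}_\beta=2\ell^2\,\Phi\Big(-\frac{\ell\,J(\beta)^{1/2}}{\sqrt2}\Big).$$ 2. If $J(\beta)>0$, this limit, as a function of $\ell>0$, has exactly one maximiser; if $J(\beta)=0$, it has none. 3. If $\ell$ is a maximiser, then, with $\epsilon=\ell/d^{1/2}$, the swap acceptance rate $\mathbb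 E[\alpha_\beta(x,y)]$ converges as $d\to\infty$ to a number equal to $0.234$ to three significant figures (i.e. in $[0.2335,0.2345)$). -/

import Mathlib

open Real Set Filter Topology MeasureTheory ProbabilityTheory

noncomputable section

namespace QuanTA

/-- `f` is unimodal with its maximum at `m`. -/
def IsUnimodalAt (f : ℝ → ℝ) (m : ℝ) : Prop :=
  MonotoneOn f (Iic m) ∧ AntitoneOn f (Ici m)

/-- `H` is regularly varying with positive index: for some `a > 0` and all `x > 0`,
`H (t x) / H t → x ^ a` as `|t| → ∞`. -/
def IsRegularlyVarying (H : ℝ → ℝ) : Prop :=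
  ∃ a : ℝ, 0 < a ∧ ∀ x : ℝ, 0 < x →
    Tendsto (fun t : ℝ => H (t * x) / H t) (atBot ⊔ atTop) (𝓝 (x ^ a))

/-- The probability law with Lebesgue density proportional to `p ^ b`
(the power-tempered target at inverse temperature `b`). -/
def tempered {E : Type*} [MeasureSpace E] (p : E → ℝ) (b : ℝ) : Measure E :=
  (∫⁻ x, ENNReal.ofReal (p x ^ b))⁻¹ •
    (volume : Measure E).withDensity (fun x => ENNReal.ofReal (p x ^ b))

/-- `f_d (x) = ∏ i, f (x i)`. -/
def prodDensity (f : ℝ → ℝ) (d : ℕ) (x : Fin d → ℝ) : ℝ := ∏ i, f (x i)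

/-- The rescaling `g (x, b, b') = (b / b') ^ (1/2) (x - m) + m` about the mode point
`(m, ..., m)` of the product target. -/
def rescale {d : ℕ} (m b b' : ℝ) (x : Fin d → ℝ) : Fin d → ℝ :=
  fun i => √(b / b') * (x i - m) + m

/-- Acceptance probability of the QuanTA swap between `x` (at level `b`) and `y` (at level `b'`). -/
def acceptProb (f : ℝ → ℝ) (m b b' : ℝ) {d : ℕ} (x y : Fin d → ℝ) : ℝ :=
  min 1 ((prodDensity f d (rescale m b b' x) ^ b' * prodDensity f d (rescale m b' b y) ^ b) /
    (prodDensity f d y ^ b' * prodDensity f d x ^ b))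

/-- Stationary law of the pair of states at the two levels `b` and `b'`. -/
def pairLaw (f : ℝ → ℝ) (d : ℕ) (b b' : ℝ) : Measure ((Fin d → ℝ) × (Fin d → ℝ)) :=
  (tempered (prodDensity f d) b).prod (tempered (prodDensity f d) b')

/-- Conditional law of the level `γ` given the states: `γ = b'` if the proposed swap is accepted,
`γ = b` if it is rejected. -/
def levelLaw (f : ℝ → ℝ) (m b b' : ℝ) {d : ℕ} (x y : Fin d → ℝ) : Measure ℝ :=
  ENNReal.ofReal (acceptProb f m b b' x y) • Measure.dirac b' +
    ENNReal.ofReal (1 - acceptProb f m b b' x y) • Measure.dirac b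

/-- Expected squared jumping distance `E [(γ - b)²]` in stationarity, for the levels
`b` and `b + ε`. -/
def ESJD (f : ℝ → ℝ) (m : ℝ) (d : ℕ) (b ε : ℝ) : ℝ :=
  ∫ z, (∫ γ, (γ - b) ^ 2 ∂(levelLaw f m b (b + ε) z.1 z.2)) ∂(pairLaw f d b (b + ε))

/-- Expected acceptance probability of the swap in stationarity, for the levels `b` and `b + ε`. -/
def acceptRate (f : ℝ → ℝ) (m : ℝ) (d : ℕ) (b ε : ℝ) : ℝ :=
  ∫ z, acceptProb f m b (b + ε) z.1 z.2 ∂(pairLaw f d b (b + ε))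

/-- `h = log f`. -/
def h (f : ℝ → ℝ) (x : ℝ) : ℝ := Real.log (f x)

/-- `k (x) = (x - m) (log f)' (x)`. -/
def k (f : ℝ → ℝ) (m x : ℝ) : ℝ := (x - m) * deriv (h f) x

/-- `r (x) = (x - m)² (log f)'' (x)`. -/
def r (f : ℝ → ℝ) (m x : ℝ) : ℝ := (x - m) ^ 2 * iteratedDeriv 2 (h f) x

/-- `V (b) = Cov_b (log f, (x - m) (log f)')`, under the law with density proportional to `f ^ b`. -/
def V (f : ℝ → ℝ) (m b : ℝ) : ℝ := covariance (h f) (k f m) (tempered f b)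

/-- `I (b) = Var_b (log f)`. -/
def I (f : ℝ → ℝ) (b : ℝ) : ℝ := variance (h f) (tempered f b)

/-- `R (b) = E_b [(x - m)² (log f)'' - (x - m) (log f)']`. -/
def R (f : ℝ → ℝ) (m b : ℝ) : ℝ := ∫ x, (r f m x - k f m x) ∂(tempered f b)

/-- `J (b) = I (b) - V (b) / 2 - R (b) / (4 b)`. -/
def J (f : ℝ → ℝ) (m b : ℝ) : ℝ := I f b - V f m b / 2 - R f m b / (4 * b)

/-- The standard normal distribution function. -/
def Phi (x : ℝ) : ℝ := cdf (gaussianReal 0 1) x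

/-- The limiting efficiency `2 ℓ² Φ (- ℓ J^(1/2) / √2)`. -/
def limitEff (f : ℝ → ℝ) (m b ℓ : ℝ) : ℝ := 2 * ℓ ^ 2 * Phi (-(ℓ * √(J f m b)) / √2)

end QuanTA

end

/-! Write `h = log f` and let `L` be the logarithm of the acceptance ratio, a sum over the
coordinates of the two states. The substitution `y = scaleMap x` turns the hot contribution
`backRatio` into `-logRatio` and the hot density into the cold one tilted by `exp logRatio`. With
`N(z) = ∫ exp (z * logRatio) * exp (b * h)`, this gives the characteristic function of `L` exactly:
it is the `d`-th power of `N(it) N(1 - it) / (N(1) N(0))` (`charFun_map_logAccept`).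

The `ε`-derivative of `logRatio` is `score ∘ scaleMap`, with `score = h - k / 2`. In the
second-order expansion of the ratio at `ε = 0`, every contribution linear in `z` cancels, because
the exponents in numerator and denominator have the same sum. What remains is `1 - it(1 - it)
Var(score) ε² + o(ε²)` (`tendsto_mgfInt_ratio`). Integration by parts identifies `Var(score)` with
`J` (`J_eq_variance`), so `J ≥ 0`.

For `ε² = ℓ² / d` the power converges to the characteristic function of a normal law with variance
`s² = 2 ℓ² J` and mean `-s² / 2`. By Lévy's continuity theorem the acceptance rate tends to the
Gaussian mean of `min 1 (exp x)`, which is `2 Φ(-s / 2)` (`tendsto_acceptRate`).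

In the variable `u = s / 2` the efficiency is a multiple of `u² Φ(-u)`. Its derivative is `u *
effSlope u`; `effSlope` falls up to `√3`, then rises to its limit `0`, so it has one positive zero.
Taylor bounds place this zero between `1.185` and `1.193`, where `2 Φ(-u) = u φ(u)`, with `φ` the
standard normal density, gives `0.234`.

The integrals are controlled by the class `Tame`. The bound on the fourth derivative makes `h` and
its derivatives grow polynomially, and regular variation with unimodality makes `H` dominate a
positive power of `|x|`. -/

noncomputable section

namespace QuanTA

/-! ### Polynomial growth -/

/-- `g` grows at most polynomially. -/
def PolyGrowth (g : ℝ → ℝ) : Prop :=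
  ∃ C : ℝ, ∃ n : ℕ, 0 ≤ C ∧ ∀ x, |g x| ≤ C * (1 + |x|) ^ n

namespace PolyGrowth

variable {u v : ℝ → ℝ}

lemma const (c : ℝ) : PolyGrowth fun _ => c :=
  ⟨|c|, 0, abs_nonneg c, fun x => by simp⟩

lemma id : PolyGrowth fun x => x :=
  ⟨1, 1, zero_le_one, fun x => by linarith [abs_nonneg x]⟩

lemma mul (hu : PolyGrowth u) (hv : PolyGrowth v) : PolyGrowth fun x => u x * v x := by
  obtain ⟨C, n, hC, h₁⟩ := hu
  obtain ⟨D, k, hD, h₂⟩ := hv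
  refine ⟨C * D, n + k, by positivity, fun x => ?_⟩
  rw [abs_mul, pow_add]
  calc |u x| * |v x| ≤ (C * (1 + |x|) ^ n) * (D * (1 + |x|) ^ k) := by
        gcongr
        exacts [h₁ x, h₂ x]
    _ = _ := by ring

lemma add (hu : PolyGrowth u) (hv : PolyGrowth v) : PolyGrowth fun x => u x + v x := by
  obtain ⟨C, n, hC, h₁⟩ := hu
  obtain ⟨D, k, hD, h₂⟩ := hv
  refine ⟨C + D, n + k, by positivity, fun x => ?_⟩
  have h1 : (1 : ℝ) ≤ 1 + |x| := by linarith [abs_nonneg x]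
  calc |u x + v x| ≤ |u x| + |v x| := abs_add_le _ _
    _ ≤ C * (1 + |x|) ^ n + D * (1 + |x|) ^ k := add_le_add (h₁ x) (h₂ x)
    _ ≤ C * (1 + |x|) ^ (n + k) + D * (1 + |x|) ^ (n + k) := by
        gcongr <;> first | exact h1 | omega
    _ = _ := by ring

lemma neg (hu : PolyGrowth u) : PolyGrowth fun x => -u x := by
  simpa using (const (-1)).mul hu

lemma sub (hu : PolyGrowth u) (hv : PolyGrowth v) : PolyGrowth fun x => u x - v x := by
  simpa [sub_eq_add_neg] using hu.add hv.neg

lemma pow (hu : PolyGrowth u) (k : ℕ) : PolyGrowth fun x => u x ^ k := by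
  induction k with
  | zero => simpa using const 1
  | succ k ih => simpa [pow_succ] using ih.mul hu

/-- A function whose derivative grows at most polynomially does so too. -/
lemma of_deriv (hu : Differentiable ℝ u) (hd : PolyGrowth (deriv u)) : PolyGrowth u := by
  obtain ⟨C, n, hC, h₁⟩ := hd
  refine ⟨|u 0| + C, n + 1, by positivity, fun x => ?_⟩
  have h1 : (1 : ℝ) ≤ 1 + |x| := by linarith [abs_nonneg x]
  have key : ‖u x - u 0‖ ≤ C * (1 + |x|) ^ n * ‖x - 0‖ := by
    refine (convex_closedBall (0 : ℝ) |x|).norm_image_sub_le_of_norm_deriv_le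
      (fun y _ => hu y) (fun y hy => ?_) (by simp) (by simp)
    have hy' : |y| ≤ |x| := by simpa using hy
    exact (h₁ y).trans (by gcongr)
  rw [Real.norm_eq_abs, sub_zero, Real.norm_eq_abs] at key
  have h2 : (1 : ℝ) ≤ (1 + |x|) ^ (n + 1) := one_le_pow₀ h1
  calc |u x| ≤ |u 0| + |u x - u 0| := by
        have := abs_add_le (u 0) (u x - u 0); simpa using this
    _ ≤ |u 0| * (1 + |x|) ^ (n + 1) + C * (1 + |x|) ^ n * (1 + |x|) := by
        have := abs_nonneg (u 0)
        have h3 : C * (1 + |x|) ^ n * |x| ≤ C * (1 + |x|) ^ n * (1 + |x|) := by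
          gcongr; linarith
        nlinarith
    _ = _ := by ring

end PolyGrowth

/-! ### Growth of monotone functions with expanding dyadic ratios -/

/-- Each doubling of the argument eventually multiplies `G` by at least some fixed `ρ > 1`.
Iterating from the base block `[t, 2t)` gives growth of order `x ^ δ` with `2 ^ δ = ρ`. -/
lemma exists_rpow_le_of_tendsto_ratio {G : ℝ → ℝ} {a L : ℝ} (hmono : MonotoneOn G (Ici a))
    (hL : 1 < L) (hG : Tendsto (fun t => G (t * 2) / G t) atTop (𝓝 L)) :
    ∃ c δ t : ℝ, 0 < c ∧ 0 < δ ∧ 0 < t ∧ ∀ x, t ≤ x → c * x ^ δ ≤ G x := by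
  obtain ⟨ρ, hρ, hρL⟩ := exists_between hL
  obtain ⟨t, ht⟩ := eventually_atTop.1
    ((hG.eventually (lt_mem_nhds hρL)).and (eventually_ge_atTop (max a 1)))
  have hta : ∀ x, t ≤ x → a ≤ x ∧ 1 ≤ x := fun x hx => by simpa using (ht x hx).2
  have hpos : ∀ x, t ≤ x → 0 < G x ∧ ρ * G x ≤ G (x * 2) := by
    intro x hx
    have hr := (ht x hx).1
    have hm : G x ≤ G (x * 2) :=
      hmono (hta x hx).1 (mem_Ici.2 (by linarith [hta x hx])) (by linarith [hta x hx])
    -- A negative value would make the ratio bound contradict monotonicity, and a zero value makes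
    -- the quotient `0` by convention. Hence `G x > 0`.
    rcases lt_trichotomy (G x) 0 with h0 | h0 | h0
    · rw [lt_div_iff_of_neg h0] at hr
      nlinarith
    · rw [h0, div_zero] at hr
      linarith
    · rw [lt_div_iff₀ h0] at hr
      exact ⟨h0, hr.le⟩
  have ht1 : 1 ≤ t := (hta t le_rfl).2
  have hρ0 : 0 < ρ := by linarith
  set δ := Real.logb 2 ρ with hδ
  have hδ0 : 0 < δ := Real.logb_pos (by norm_num) hρ
  have h2δ : (2 : ℝ) ^ δ = ρ := Real.rpow_logb (by norm_num) (by norm_num) hρ0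
  have hc : 0 < G t / (t * 2) ^ δ := div_pos (hpos t le_rfl).1 (by positivity)
  refine ⟨G t / (t * 2) ^ δ, δ, t, hc, hδ0, by linarith, ?_⟩
  have main : ∀ n : ℕ, ∀ x, t ≤ x → x < t * 2 ^ (n + 1) → G t / (t * 2) ^ δ * x ^ δ ≤ G x := by
    intro n
    induction n with
    | zero =>
      intro x hx hx2
      calc G t / (t * 2) ^ δ * x ^ δ ≤ G t / (t * 2) ^ δ * (t * 2) ^ δ := by
            have : x ≤ t * 2 := by simpa using hx2.le
            have : 0 ≤ x := by linarith
            gcongr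
        _ = G t := div_mul_cancel₀ _ (by positivity)
        _ ≤ G x := hmono (hta t le_rfl).1 (hta x hx).1 hx
    | succ n ih =>
      intro x hx hx2
      by_cases hx3 : x < t * 2
      · calc G t / (t * 2) ^ δ * x ^ δ ≤ G t / (t * 2) ^ δ * (t * 2) ^ δ := by
              have : 0 ≤ x := by linarith
              gcongr
          _ = G t := div_mul_cancel₀ _ (by positivity)
          _ ≤ G x := hmono (hta t le_rfl).1 (hta x hx).1 hx
      · have hx4 : t ≤ x / 2 := by linarith
        have h5 := ih (x / 2) hx4 (by rw [pow_succ] at hx2; linarith)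
        have h6 := (hpos (x / 2) hx4).2
        have h7 : x ^ δ = (x / 2) ^ δ * ρ := by
          rw [← h2δ, ← Real.mul_rpow (by linarith) (by norm_num)]
          congr 1; ring
        rw [div_mul_cancel₀ x (by norm_num : (2 : ℝ) ≠ 0)] at h6
        rw [h7]
        nlinarith
  intro x hx
  obtain ⟨n, hn⟩ := pow_unbounded_of_one_lt (x / t) (one_lt_two : (1 : ℝ) < 2)
  refine main n x hx ?_
  rw [div_lt_iff₀ (by linarith)] at hn
  have : (2 : ℝ) ^ n ≤ 2 ^ (n + 1) := pow_le_pow_right₀ (by norm_num) (by omega)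
  nlinarith

/-- For `x ≥ 1` one has `(1 + x) ^ n ≤ 2 ^ n * x ^ n`. In the variable `X = x ^ δ` this is the decay
of `X ^ (n / δ) * exp (-(b * c * X))`. -/
lemma tendsto_pow_mul_exp_neg_of_rpow_le {G : ℝ → ℝ} {c δ t : ℝ} (hc : 0 < c) (hδ : 0 < δ)
    (hG : ∀ x, t ≤ x → c * x ^ δ ≤ G x) {b : ℝ} (hb : 0 < b) (n : ℕ) :
    Tendsto (fun x => (1 + |x|) ^ n * exp (-(b * G x))) atTop (𝓝 0) := by
  have h1 := ((tendsto_rpow_mul_exp_neg_mul_atTop_nhds_zero (n / δ) (b * c)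
    (by positivity)).comp (tendsto_rpow_atTop hδ)).const_mul ((2 : ℝ) ^ n)
  rw [mul_zero] at h1
  refine squeeze_zero' (Eventually.of_forall fun x => by positivity) ?_ h1
  filter_upwards [eventually_ge_atTop t, eventually_ge_atTop 1] with x hx hx1
  have h2 : (x ^ δ) ^ (n / δ) = x ^ n := by
    rw [← Real.rpow_mul (by linarith), mul_div_cancel₀ _ hδ.ne', Real.rpow_natCast]
  simp only [Function.comp_apply, h2]
  rw [← mul_assoc, ← mul_pow, abs_of_nonneg (by linarith)]
  have h3 : b * (c * x ^ δ) ≤ b * G x := mul_le_mul_of_nonneg_left (hG x hx) hb.le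
  gcongr
  · linarith
  · linarith

/-! ### Tame log-densities -/

/-- A `C²` function with polynomially growing derivatives whose exponential, raised to any
positive power, decays faster than every polynomial. -/
structure Tame (φ : ℝ → ℝ) : Prop where
  contDiff : ContDiff ℝ 2 φ
  growth : PolyGrowth φ
  growth_deriv : PolyGrowth (deriv φ)
  growth_deriv_two : PolyGrowth (iteratedDeriv 2 φ)
  decay : ∀ b : ℝ, 0 < b → ∀ n : ℕ, ∃ C : ℝ, ∀ x, (1 + |x|) ^ n * exp (b * φ x) ≤ C

lemma exists_bound_of_tendsto {u : ℝ → ℝ} (hu : Continuous u) (h₁ : Tendsto u atTop (𝓝 0))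
    (h₂ : Tendsto u atBot (𝓝 0)) : ∃ C : ℝ, ∀ x, u x ≤ C := by
  obtain ⟨A, hA⟩ := eventually_atTop.1 (h₁.eventually (ge_mem_nhds (zero_lt_one' ℝ)))
  obtain ⟨B, hB⟩ := eventually_atBot.1 (h₂.eventually (ge_mem_nhds (zero_lt_one' ℝ)))
  obtain ⟨C, hC⟩ := (isCompact_Icc (a := B) (b := A)).bddAbove_image hu.continuousOn
  refine ⟨max C 1, fun x => ?_⟩
  rcases le_total A x with h | h
  · exact (hA x h).trans (le_max_right _ _)
  rcases le_total x B with h' | h'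
  · exact (hB x h').trans (le_max_right _ _)
  exact (hC ⟨x, ⟨h', h⟩, rfl⟩).trans (le_max_left _ _)

/-- Only the dilation factor `2` of regular variation is needed, since `2 ^ a > 1`. The left tail
reduces to the right one by reflection. -/
lemma decay_of_regularlyVarying {H : ℝ → ℝ} {m : ℝ} (hH : Continuous H)
    (hanti : AntitoneOn H (Iic m)) (hmono : MonotoneOn H (Ici m)) (hreg : IsRegularlyVarying H)
    {b : ℝ} (hb : 0 < b) (n : ℕ) : ∃ C : ℝ, ∀ x, (1 + |x|) ^ n * exp (-(b * H x)) ≤ C := by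
  obtain ⟨a, ha, hlim⟩ := hreg
  have hL : (1 : ℝ) < 2 ^ a := Real.one_lt_rpow (by norm_num) ha
  have h2 := hlim 2 (by norm_num)
  rw [tendsto_sup] at h2
  have hcont : Continuous fun x => (1 + |x|) ^ n * exp (-(b * H x)) := by fun_prop
  refine exists_bound_of_tendsto hcont ?_ ?_
  · obtain ⟨c, δ, t, hc, hδ, -, hG⟩ := exists_rpow_le_of_tendsto_ratio hmono hL h2.2
    exact tendsto_pow_mul_exp_neg_of_rpow_le hc hδ hG hb n
  · have hmono' : MonotoneOn (fun x => H (-x)) (Ici (-m)) := fun x hx y hy hxy =>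
      hanti (by simp only [mem_Iic, mem_Ici] at *; linarith)
        (by simp only [mem_Iic, mem_Ici] at *; linarith) (by linarith)
    have h3 : Tendsto (fun t => H (-(t * 2)) / H (-t)) atTop (𝓝 (2 ^ a)) := by
      simpa [Function.comp_def] using h2.1.comp tendsto_neg_atTop_atBot
    obtain ⟨c, δ, t, hc, hδ, -, hG⟩ := exists_rpow_le_of_tendsto_ratio hmono' hL h3
    have := (tendsto_pow_mul_exp_neg_of_rpow_le hc hδ hG hb n).comp tendsto_neg_atBot_atTop
    simpa [Function.comp_def] using this

/-- Polynomial growth descends from the bounded fourth derivative to the function itself, one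
integration at a time. -/
lemma tame_log {f H : ℝ → ℝ} {m : ℝ} (hfH : ∀ x, f x = exp (-H x)) (hsmooth : ContDiff ℝ 4 f)
    (hunimodal : IsUnimodalAt f m) (hregular : IsRegularlyVarying H)
    (hfourth : ∃ M : ℝ, 0 < M ∧ ∀ z, |iteratedDeriv 4 (fun x => Real.log (f x)) z| < M) :
    Tame (h f) := by
  have hpos : ∀ x, 0 < f x := fun x => by rw [hfH]; positivity
  have hh : ∀ x, h f x = -H x := fun x => by rw [h, hfH, Real.log_exp]
  have hC4 : ContDiff ℝ 4 (h f) := hsmooth.log fun x => (hpos x).ne'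
  have step : ∀ j : ℕ, j < 4 → PolyGrowth (iteratedDeriv (j + 1) (h f)) →
      PolyGrowth (iteratedDeriv j (h f)) := by
    intro j hj hg
    refine PolyGrowth.of_deriv (hC4.differentiable_iteratedDeriv j (by exact_mod_cast hj)) ?_
    rwa [← iteratedDeriv_succ]
  have g4 : PolyGrowth (iteratedDeriv 4 (h f)) := by
    obtain ⟨M, hM, hb⟩ := hfourth
    exact ⟨M, 0, hM.le, fun x => by rw [pow_zero, mul_one]; exact (hb x).le⟩
  have g3 := step 3 (by norm_num) g4
  have g2 := step 2 (by norm_num) g3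
  have g1 := step 1 (by norm_num) g2
  have g0 := step 0 (by norm_num) g1
  have hHc : Continuous H := by
    have : H = fun x => -h f x := by ext x; rw [hh, neg_neg]
    rw [this]
    exact hC4.continuous.neg
  have hle : ∀ x y, f x ≤ f y → H y ≤ H x := fun x y hxy => by
    rw [hfH, hfH, Real.exp_le_exp] at hxy; linarith
  refine ⟨hC4.of_le (by norm_num), by simpa using g0, by simpa using g1, g2, fun b hb n => ?_⟩
  obtain ⟨C, hC⟩ := decay_of_regularlyVarying hHc
    (fun x hx y hy hxy => hle _ _ (hunimodal.1 hx hy hxy))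
    (fun x hx y hy hxy => hle _ _ (hunimodal.2 hx hy hxy)) hregular hb n
  exact ⟨C, fun x => by simpa [hh] using hC x⟩

/-- The inverse powers `(1 + |x|)⁻²` are integrable. -/
lemma integrable_inv_one_add_abs_sq : Integrable fun x : ℝ => ((1 + |x|) ^ 2)⁻¹ := by
  have := integrable_one_add_norm (E := ℝ) (μ := volume) (r := 2) (by simp)
  refine this.congr (Eventually.of_forall fun x => ?_)
  have : (0 : ℝ) < 1 + |x| := by positivity
  simp only [Real.norm_eq_abs]
  rw [Real.rpow_neg this.le]
  norm_cast

lemma integrable_of_pow_mul_le {u : ℝ → ℝ} (hu : Continuous u) {C : ℝ}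
    (hC : ∀ x, (1 + |x|) ^ 2 * |u x| ≤ C) : Integrable u := by
  refine (integrable_inv_one_add_abs_sq.const_mul C).mono' hu.aestronglyMeasurable
    (Eventually.of_forall fun x => ?_)
  have : (0 : ℝ) < (1 + |x|) ^ 2 := by positivity
  rw [← div_eq_mul_inv, le_div_iff₀ this, mul_comm]
  exact hC x

namespace Tame

variable {φ : ℝ → ℝ}

lemma integrable_mul_exp (hφ : Tame φ) {u : ℝ → ℝ} (hu : Continuous u) (hg : PolyGrowth u)
    {b : ℝ} (hb : 0 < b) : Integrable fun x => u x * exp (b * φ x) := by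
  obtain ⟨C, n, hC, hCn⟩ := hg
  obtain ⟨D, hD⟩ := hφ.decay b hb (2 + n)
  have := hφ.contDiff.continuous
  refine integrable_of_pow_mul_le (by fun_prop) (C := C * D) fun x => ?_
  rw [abs_mul, abs_of_pos (exp_pos _)]
  calc (1 + |x|) ^ 2 * (|u x| * exp (b * φ x))
      ≤ (1 + |x|) ^ 2 * (C * (1 + |x|) ^ n * exp (b * φ x)) := by gcongr; exact hCn x
    _ = C * ((1 + |x|) ^ (2 + n) * exp (b * φ x)) := by ring
    _ ≤ C * D := by gcongr; exact hD x

lemma integrable_exp (hφ : Tame φ) {b : ℝ} (hb : 0 < b) : Integrable fun x => exp (b * φ x) := by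
  simpa using hφ.integrable_mul_exp continuous_const (PolyGrowth.const 1) hb

lemma integral_exp_pos (hφ : Tame φ) {b : ℝ} (hb : 0 < b) : 0 < ∫ x, exp (b * φ x) :=
  _root_.MeasureTheory.integral_exp_pos (hφ.integrable_exp hb)

end Tame

/-! ### Integration against tempered laws -/

section Tempered

variable {E : Type*} [MeasureSpace E] {p : E → ℝ} {b : ℝ}

lemma lintegral_rpow_eq (hpos : ∀ x, 0 < p x) (hint : Integrable fun x => p x ^ b) :
    ∫⁻ x, ENNReal.ofReal (p x ^ b) = ENNReal.ofReal (∫ x, p x ^ b) :=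
  (ofReal_integral_eq_lintegral_ofReal hint
    (Eventually.of_forall fun x => (Real.rpow_pos_of_pos (hpos x) b).le)).symm

lemma isProbabilityMeasure_tempered (hpos : ∀ x, 0 < p x) (hint : Integrable fun x => p x ^ b)
    (hZ : 0 < ∫ x, p x ^ b) : IsProbabilityMeasure (tempered p b) := by
  refine ⟨?_⟩
  rw [tempered, Measure.smul_apply, withDensity_apply _ MeasurableSet.univ, Measure.restrict_univ,
    smul_eq_mul, lintegral_rpow_eq hpos hint]
  exact ENNReal.inv_mul_cancel (by simpa using hZ) ENNReal.ofReal_ne_top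

lemma integral_tempered {F : Type*} [NormedAddCommGroup F] [NormedSpace ℝ F]
    (hpos : ∀ x, 0 < p x) (hm : Measurable p) (hint : Integrable fun x => p x ^ b) (u : E → F) :
    ∫ x, u x ∂(tempered p b) = (∫ x, p x ^ b)⁻¹ • ∫ x, p x ^ b • u x := by
  have h0 : ∀ x, 0 ≤ p x ^ b := fun x => (Real.rpow_pos_of_pos (hpos x) b).le
  rw [tempered, integral_smul_measure, integral_withDensity_eq_integral_toReal_smul
    (by fun_prop) (Eventually.of_forall fun x => ENNReal.ofReal_lt_top),
    lintegral_rpow_eq hpos hint, ENNReal.toReal_inv, ENNReal.toReal_ofReal (integral_nonneg h0)]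
  simp only [ENNReal.toReal_ofReal (h0 _)]

lemma integrable_tempered {F : Type*} [NormedAddCommGroup F] [NormedSpace ℝ F]
    (hpos : ∀ x, 0 < p x) (hm : Measurable p) (hint : Integrable fun x => p x ^ b)
    (hZ : 0 < ∫ x, p x ^ b) {u : E → F} (hu : Integrable fun x => p x ^ b • u x) :
    Integrable u (tempered p b) := by
  have h0 : ∀ x, 0 ≤ p x ^ b := fun x => (Real.rpow_pos_of_pos (hpos x) b).le
  refine Integrable.smul_measure ?_ ?_
  · rw [integrable_withDensity_iff_integrable_smul' (by fun_prop)
      (Eventually.of_forall fun x => ENNReal.ofReal_lt_top)]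
    simpa only [ENNReal.toReal_ofReal (h0 _)] using hu
  · rw [lintegral_rpow_eq hpos hint]
    simpa using hZ

end Tempered

/-! ### Moments of the one-dimensional law -/

lemma rpow_eq_exp_h {f : ℝ → ℝ} (hpos : ∀ x, 0 < f x) (b x : ℝ) :
    f x ^ b = exp (b * h f x) := by
  rw [h, Real.rpow_def_of_pos (hpos x), mul_comm]

section Moments

variable {f : ℝ → ℝ} (hpos : ∀ x, 0 < f x) (hf : Measurable f) (hφ : Tame (h f)) {b : ℝ}

include hpos hφ in
lemma integrable_rpow_of_tame (hb : 0 < b) : Integrable fun x => f x ^ b := by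
  simpa only [rpow_eq_exp_h hpos] using hφ.integrable_exp hb

include hpos hφ in
lemma integral_rpow_pos_of_tame (hb : 0 < b) : 0 < ∫ x, f x ^ b := by
  simpa only [rpow_eq_exp_h hpos] using hφ.integral_exp_pos hb

include hpos hφ in
lemma isProbabilityMeasure_tempered_of_tame (hb : 0 < b) : IsProbabilityMeasure (tempered f b) :=
  isProbabilityMeasure_tempered hpos (integrable_rpow_of_tame hpos hφ hb)
    (integral_rpow_pos_of_tame hpos hφ hb)

include hpos hf hφ in
lemma integral_tempered_of_tame (hb : 0 < b) (u : ℝ → ℝ) :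
    ∫ x, u x ∂(tempered f b) = (∫ x, u x * exp (b * h f x)) / ∫ x, exp (b * h f x) := by
  rw [integral_tempered hpos hf (integrable_rpow_of_tame hpos hφ hb)]
  simp only [rpow_eq_exp_h hpos, smul_eq_mul, div_eq_inv_mul, mul_comm (u _)]

include hpos hf hφ in
lemma integrable_tempered_of_polyGrowth (hb : 0 < b) {u : ℝ → ℝ} (hu : Continuous u)
    (hg : PolyGrowth u) : Integrable u (tempered f b) := by
  refine integrable_tempered hpos hf (integrable_rpow_of_tame hpos hφ hb)
    (integral_rpow_pos_of_tame hpos hφ hb) ?_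
  simpa only [rpow_eq_exp_h hpos, smul_eq_mul, mul_comm] using hφ.integrable_mul_exp hu hg hb

include hpos hf hφ in
lemma memLp_two_tempered_of_polyGrowth (hb : 0 < b) {u : ℝ → ℝ} (hu : Continuous u)
    (hg : PolyGrowth u) : MemLp u 2 (tempered f b) :=
  (memLp_two_iff_integrable_sq hu.aestronglyMeasurable).2
    (integrable_tempered_of_polyGrowth hpos hf hφ hb (hu.pow 2) (hg.pow 2))

include hφ in
lemma continuous_k (m : ℝ) : Continuous (k f m) := by
  have := hφ.contDiff.continuous_deriv (by norm_num)
  unfold k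
  fun_prop

include hφ in
lemma continuous_r (m : ℝ) : Continuous (r f m) := by
  have := hφ.contDiff.continuous_iteratedDeriv 2 (by norm_num)
  unfold r
  fun_prop

include hφ in
lemma polyGrowth_k (m : ℝ) : PolyGrowth (k f m) :=
  (PolyGrowth.id.sub (PolyGrowth.const m)).mul hφ.growth_deriv

include hφ in
lemma polyGrowth_r (m : ℝ) : PolyGrowth (r f m) :=
  ((PolyGrowth.id.sub (PolyGrowth.const m)).pow 2).mul hφ.growth_deriv_two

include hφ in
lemma hasDerivAt_h (x : ℝ) : HasDerivAt (h f) (deriv (h f) x) x :=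
  (hφ.contDiff.differentiable (by norm_num) x).hasDerivAt

include hφ in
lemma hasDerivAt_deriv_h (x : ℝ) : HasDerivAt (deriv (h f)) (iteratedDeriv 2 (h f) x) x := by
  have h1 : Differentiable ℝ (iteratedDeriv 1 (h f)) :=
    hφ.contDiff.differentiable_iteratedDeriv 1 (by norm_num)
  rw [iteratedDeriv_one] at h1
  rw [iteratedDeriv_succ, iteratedDeriv_one]
  exact (h1 x).hasDerivAt

include hφ in
/-- Integration by parts against `exp (b h)`. -/
lemma integral_deriv_add_mul_exp (hb : 0 < b) {u u' : ℝ → ℝ} (hu : ∀ x, HasDerivAt u (u' x) x)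
    (hu' : Continuous u') (hg : PolyGrowth u) (hg' : PolyGrowth u') :
    ∫ x, (u' x + b * (deriv (h f) x * u x)) * exp (b * h f x) = 0 := by
  have hc : Continuous u := continuous_iff_continuousAt.2 fun x => (hu x).continuousAt
  have hd := hφ.contDiff.continuous_deriv (by norm_num)
  refine integral_eq_zero_of_hasDerivAt_of_integrable (f := fun x => u x * exp (b * h f x))
    (fun x => ?_) ?_ (hφ.integrable_mul_exp hc hg hb)
  · exact ((hu x).fun_mul (((hasDerivAt_h hφ x).const_mul b).exp)).congr_deriv (by ring)
  · exact hφ.integrable_mul_exp (by fun_prop)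
      (hg'.add ((PolyGrowth.const b).mul (hφ.growth_deriv.mul hg))) hb

include hpos hf hφ in
lemma integral_tempered_deriv_add (hb : 0 < b) {u u' : ℝ → ℝ}
    (hu : ∀ x, HasDerivAt u (u' x) x) (hu' : Continuous u') (hg : PolyGrowth u)
    (hg' : PolyGrowth u') :
    ∫ x, (u' x + b * (deriv (h f) x * u x)) ∂(tempered f b) = 0 := by
  rw [integral_tempered_of_tame hpos hf hφ hb, integral_deriv_add_mul_exp hφ hb hu hu' hg hg',
    zero_div]

include hpos hf hφ in
-- Integration by parts with `u = x - m`. The next two identities use `u = (x - m) * h` and `u = (x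
-- - m) * k`.
lemma integral_k (m : ℝ) (hb : 0 < b) : ∫ x, k f m x ∂(tempered f b) = -1 / b := by
  have := isProbabilityMeasure_tempered_of_tame hpos hφ hb
  have h1 := integral_tempered_deriv_add hpos hf hφ hb (u := fun x => x - m) (u' := fun _ => 1)
    (fun x => (hasDerivAt_id x).sub_const m) continuous_const
    (PolyGrowth.id.sub (PolyGrowth.const m)) (PolyGrowth.const 1)
  have hk := integrable_tempered_of_polyGrowth hpos hf hφ hb (continuous_k hφ m) (polyGrowth_k hφ m)
  have h2 : ∫ x, (1 + b * k f m x) ∂(tempered f b) = 0 := by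
    rw [← h1]; congr 1; ext x; rw [k]; ring
  rw [integral_add (integrable_const _) (hk.const_mul b), integral_const_mul] at h2
  simp only [integral_const, probReal_univ, one_smul] at h2
  field_simp
  linarith

include hpos hf hφ in
lemma integral_h_mul_k (m : ℝ) (hb : 0 < b) :
    ∫ x, h f x * k f m x ∂(tempered f b) = 1 / b ^ 2 - (∫ x, h f x ∂(tempered f b)) / b := by
  have hc := hφ.contDiff.continuous
  have hkc := continuous_k hφ m
  have hkg := polyGrowth_k hφ m
  have h1 := integral_tempered_deriv_add hpos hf hφ hb (u := fun x => (x - m) * h f x)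
    (u' := fun x => h f x + k f m x)
    (fun x => (((hasDerivAt_id' x).sub_const m).fun_mul (hasDerivAt_h hφ x)).congr_deriv
      (by rw [k]; ring))
    (by fun_prop) ((PolyGrowth.id.sub (PolyGrowth.const m)).mul hφ.growth)
    (hφ.growth.add hkg)
  have i1 := integrable_tempered_of_polyGrowth hpos hf hφ hb hkc hkg
  have i2 := integrable_tempered_of_polyGrowth hpos hf hφ hb hc hφ.growth
  have i3 : Integrable (fun x => h f x * k f m x) (tempered f b) :=
    integrable_tempered_of_polyGrowth hpos hf hφ hb (hc.mul hkc) (hφ.growth.mul hkg)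
  have h2 : ∫ x, ((h f x + k f m x) + b * (h f x * k f m x)) ∂(tempered f b) = 0 := by
    rw [← h1]; congr 1; ext x; rw [k]; ring
  rw [integral_add (by exact i2.add i1) (i3.const_mul b), integral_add i2 i1, integral_const_mul,
    integral_k hpos hf hφ m hb] at h2
  field_simp at h2 ⊢
  linarith

include hpos hf hφ in
lemma integral_r (m : ℝ) (hb : 0 < b) :
    ∫ x, r f m x ∂(tempered f b) = 2 / b - b * ∫ x, k f m x ^ 2 ∂(tempered f b) := by
  have hc := hφ.contDiff.continuous_deriv (by norm_num)
  have hkc := continuous_k hφ m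
  have hkg := polyGrowth_k hφ m
  have hrc := continuous_r hφ m
  have hrg := polyGrowth_r hφ m
  have h1 := integral_tempered_deriv_add hpos hf hφ hb (u := fun x => (x - m) * k f m x)
    (u' := fun x => 2 * k f m x + r f m x)
    (fun x => by
      have h0 := (hasDerivAt_id' x).sub_const m
      exact (h0.fun_mul (h0.fun_mul (hasDerivAt_deriv_h hφ x))).congr_deriv (by rw [k, r]; ring))
    (by fun_prop) ((PolyGrowth.id.sub (PolyGrowth.const m)).mul hkg)
    (((PolyGrowth.const 2).mul hkg).add hrg)
  have i1 := integrable_tempered_of_polyGrowth hpos hf hφ hb hkc hkg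
  have i2 := integrable_tempered_of_polyGrowth hpos hf hφ hb hrc hrg
  have i3 : Integrable (fun x => k f m x ^ 2) (tempered f b) :=
    integrable_tempered_of_polyGrowth hpos hf hφ hb (hkc.pow 2) (hkg.pow 2)
  have h2 : ∫ x, ((2 * k f m x + r f m x) + b * (k f m x ^ 2)) ∂(tempered f b) = 0 := by
    rw [← h1]; congr 1; ext x; rw [k]; ring
  rw [integral_add (by exact (i1.const_mul 2).add i2) (i3.const_mul b), integral_add (i1.const_mul 2) i2,
    integral_const_mul, integral_const_mul, integral_k hpos hf hφ m hb] at h2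
  linear_combination h2

include hpos hf hφ in
lemma V_eq (m : ℝ) (hb : 0 < b) : V f m b = 1 / b ^ 2 := by
  have := isProbabilityMeasure_tempered_of_tame hpos hφ hb
  rw [V, covariance_eq_sub
    (memLp_two_tempered_of_polyGrowth hpos hf hφ hb hφ.contDiff.continuous hφ.growth)
    (memLp_two_tempered_of_polyGrowth hpos hf hφ hb (continuous_k hφ m) (polyGrowth_k hφ m)),
    integral_k hpos hf hφ m hb]
  simp only [Pi.mul_apply]
  rw [integral_h_mul_k hpos hf hφ m hb]
  ring

/-- The score `log f - (x - m) (log f)' / 2` of the swap at level `b`. -/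
def score (f : ℝ → ℝ) (m x : ℝ) : ℝ := h f x - k f m x / 2

include hφ in
lemma continuous_score (m : ℝ) : Continuous (score f m) := by
  have := hφ.contDiff.continuous
  have := continuous_k hφ m
  unfold score
  fun_prop

include hφ in
lemma polyGrowth_score (m : ℝ) : PolyGrowth (score f m) := by
  have := hφ.growth.sub ((polyGrowth_k hφ m).mul (PolyGrowth.const (1 / 2)))
  convert this using 2 with x
  rw [score]; ring

include hpos hf hφ in
-- Expanding gives `Var(score) = I - V + Var(k) / 4`. The integration-by-parts identities express `E
-- k²` through `E r`, hence `Var(k)` through `R`, and use `V = 1 / b ^ 2`.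
lemma J_eq_variance (m : ℝ) (hb : 0 < b) : J f m b = variance (score f m) (tempered f b) := by
  have := isProbabilityMeasure_tempered_of_tame hpos hφ hb
  have hc := hφ.contDiff.continuous
  have hkc := continuous_k hφ m
  have hkg := polyGrowth_k hφ m
  have i1 := integrable_tempered_of_polyGrowth hpos hf hφ hb hkc hkg
  have i2 := integrable_tempered_of_polyGrowth hpos hf hφ hb hc hφ.growth
  have i3 : Integrable (fun x => h f x * k f m x) (tempered f b) :=
    integrable_tempered_of_polyGrowth hpos hf hφ hb (hc.mul hkc) (hφ.growth.mul hkg)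
  have i4 : Integrable (fun x => k f m x ^ 2) (tempered f b) :=
    integrable_tempered_of_polyGrowth hpos hf hφ hb (hkc.pow 2) (hkg.pow 2)
  have i5 : Integrable (fun x => (h f ^ 2) x) (tempered f b) :=
    integrable_tempered_of_polyGrowth hpos hf hφ hb (hc.pow 2) (hφ.growth.pow 2)
  have i6 := integrable_tempered_of_polyGrowth hpos hf hφ hb (continuous_r hφ m) (polyGrowth_r hφ m)
  rw [J, V_eq hpos hf hφ m hb, I, R, integral_sub i6 i1, integral_r hpos hf hφ m hb,
    integral_k hpos hf hφ m hb,
    variance_eq_sub (memLp_two_tempered_of_polyGrowth hpos hf hφ hb hc hφ.growth),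
    variance_eq_sub (memLp_two_tempered_of_polyGrowth hpos hf hφ hb (continuous_score hφ m)
      (polyGrowth_score hφ m))]
  have e1 : ∫ x, score f m x ∂(tempered f b) = (∫ x, h f x ∂(tempered f b)) + 1 / (2 * b) := by
    simp only [score]
    rw [integral_sub i2 (i1.div_const 2), integral_div, integral_k hpos hf hφ m hb]
    field_simp
    ring
  have e2 : ∫ x, (score f m ^ 2) x ∂(tempered f b) = (∫ x, (h f ^ 2) x ∂(tempered f b))
      - (1 / b ^ 2 - (∫ x, h f x ∂(tempered f b)) / b)
      + (1 / 4) * ∫ x, k f m x ^ 2 ∂(tempered f b) := by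
    rw [← integral_h_mul_k hpos hf hφ m hb, ← integral_const_mul, ← integral_sub i5 i3,
      ← integral_add (by exact i5.sub i3) (i4.const_mul _)]
    congr 1; ext x
    simp only [score, Pi.pow_apply]
    ring
  rw [e1, e2]
  field_simp
  ring

end Moments

/-! ### The standard normal distribution function -/

lemma gaussianPDFReal_std (x : ℝ) :
    gaussianPDFReal 0 1 x = (√(2 * π))⁻¹ * exp (-(x ^ 2 / 2)) := by
  simp [gaussianPDFReal_def, neg_div]

lemma continuous_gaussianPDFReal_std : Continuous (gaussianPDFReal 0 1) := by
  simp only [funext gaussianPDFReal_std]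
  fun_prop

lemma Phi_eq (x : ℝ) : Phi x = (gaussianReal 0 1).real (Iic x) := cdf_eq_real _ _

lemma Phi_eq_integral (x : ℝ) : Phi x = ∫ t in Iic x, gaussianPDFReal 0 1 t := by
  rw [Phi_eq, measureReal_def, gaussianReal_apply_eq_integral _ one_ne_zero,
    ENNReal.toReal_ofReal (integral_nonneg fun t => gaussianPDFReal_nonneg _ _ _)]

lemma Phi_sub_Phi (x y : ℝ) : Phi y - Phi x = ∫ t in x..y, gaussianPDFReal 0 1 t := by
  rw [Phi_eq_integral, Phi_eq_integral]
  exact intervalIntegral.integral_Iic_sub_Iic (integrable_gaussianPDFReal 0 1).integrableOn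
    (integrable_gaussianPDFReal 0 1).integrableOn

lemma hasDerivAt_Phi (x : ℝ) : HasDerivAt Phi (gaussianPDFReal 0 1 x) x := by
  have h1 : Phi = fun y => Phi 0 + ∫ t in (0 : ℝ)..y, gaussianPDFReal 0 1 t := by
    ext y; rw [← Phi_sub_Phi]; ring
  rw [h1]
  exact (continuous_gaussianPDFReal_std.integral_hasStrictDerivAt 0 x).hasDerivAt.const_add _

lemma Phi_zero : Phi 0 = 1 / 2 := by
  have h1 : (gaussianReal 0 1).real (Ici 0) = (gaussianReal 0 1).real (Iic 0) := by
    have := gaussianReal_map_neg (μ := 0) (v := 1)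
    rw [neg_zero] at this
    conv_lhs => rw [← this]
    rw [map_measureReal_apply (by fun_prop) measurableSet_Ici]
    congr 1
    ext x
    simp
  have h2 : (gaussianReal 0 1).real (Ioi 0) = (gaussianReal 0 1).real (Ici 0) := by
    have := nullSingletonClass_gaussianReal (μ := 0) (v := 1) one_ne_zero
    exact measureReal_congr Ioi_ae_eq_Ici
  have h3 := probReal_add_probReal_compl (μ := gaussianReal 0 1) (measurableSet_Iic (a := (0 : ℝ)))
  rw [compl_Iic, h2, h1] at h3
  rw [Phi_eq]
  linarith

/-- The expected Metropolis ratio of a balanced Gaussian log-ratio. -/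
lemma integral_min_one_exp_gaussianReal (s : ℝ) (hs : 0 ≤ s) :
    ∫ x, min 1 (exp x) ∂(gaussianReal (-(s ^ 2 / 2)) (s ^ 2).toNNReal) = 2 * Phi (-(s / 2)) := by
  rcases hs.eq_or_lt with rfl | hs
  · simp [Phi_zero]
  have hv : (s ^ 2).toNNReal ≠ 0 := by simpa using hs.ne'
  set p := gaussianPDFReal (-(s ^ 2 / 2)) (s ^ 2).toNNReal with hp
  have hvs : (((s ^ 2).toNNReal : NNReal) : ℝ) = s ^ 2 := Real.coe_toNNReal _ (by positivity)
  have hpi : Integrable p := integrable_gaussianPDFReal _ _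
  -- A mean of minus half the variance is exactly what makes tilting by `exp x` a reflection. The
  -- integrand then becomes `min (p x) (p (-x))`, and its two halves are the same tail.
  have hrefl : ∀ x, p x * exp x = p (-x) := by
    intro x
    simp only [hp, gaussianPDFReal_def, hvs]
    rw [mul_assoc, ← Real.exp_add]
    congr 2
    field_simp
    ring
  -- The negative slope `-s` sends the upper tail to a lower tail of the standard law, which `Phi`
  -- measures.
  have hmeas : gaussianReal (-(s ^ 2 / 2)) (s ^ 2).toNNReal
      = (gaussianReal 0 1).map fun x => -s * x + -(s ^ 2 / 2) := by
    have h1 := gaussianReal_map_const_mul (μ := 0) (v := 1) (-s)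
    have h2 := gaussianReal_map_add_const (μ := 0) (v := (s ^ 2).toNNReal) (-(s ^ 2 / 2))
    have h3 : NNReal.mk ((-s) ^ 2) (sq_nonneg _) * 1 = (s ^ 2).toNNReal := by
      ext; simp [hvs]
    rw [h3, mul_zero] at h1
    rw [zero_add, ← h1, Measure.map_map (by fun_prop) (by fun_prop)] at h2
    exact h2.symm
  have hIci : ∫ x in Ici 0, p x = Phi (-(s / 2)) := by
    have h1 : (gaussianReal (-(s ^ 2 / 2)) (s ^ 2).toNNReal).real (Ici 0) = ∫ x in Ici 0, p x := by
      rw [measureReal_def, gaussianReal_apply_eq_integral _ hv,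
        ENNReal.toReal_ofReal (integral_nonneg fun t => gaussianPDFReal_nonneg _ _ _)]
    rw [← h1, hmeas, map_measureReal_apply (by fun_prop) measurableSet_Ici, Phi_eq]
    congr 1
    ext x
    simp only [mem_preimage, mem_Ici, mem_Iic]
    constructor <;> intro h <;> nlinarith
  have hIoi : ∫ x in Ioi 0, p x = Phi (-(s / 2)) := by rw [← integral_Ici_eq_integral_Ioi, hIci]
  have hmin : ∀ x, p x * min 1 (exp x) = min (p x) (p (-x)) := by
    intro x
    rw [mul_min_of_nonneg _ _ (gaussianPDFReal_nonneg _ _ _), mul_one, hrefl]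
  rw [integral_gaussianReal_eq_integral_smul hv]
  simp only [smul_eq_mul, ← hp, hmin]
  have hint : Integrable fun x => min (p x) (p (-x)) := hpi.inf hpi.comp_neg
  rw [← intervalIntegral.integral_Iic_add_Ioi (b := 0) hint.integrableOn hint.integrableOn]
  have e1 : ∫ x in Iic 0, min (p x) (p (-x)) = ∫ x in Iic 0, p (-x) := by
    refine setIntegral_congr_fun measurableSet_Iic fun x hx => ?_
    simp only [mem_Iic] at hx
    refine min_eq_right ?_
    rw [← hrefl]
    have := gaussianPDFReal_nonneg (-(s ^ 2 / 2)) (s ^ 2).toNNReal x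
    exact mul_le_of_le_one_right this (Real.exp_le_one_iff.2 hx)
  have e2 : ∫ x in Ioi 0, min (p x) (p (-x)) = ∫ x in Ioi 0, p x := by
    refine setIntegral_congr_fun measurableSet_Ioi fun x hx => ?_
    simp only [mem_Ioi] at hx
    refine min_eq_left ?_
    rw [← hrefl]
    have := gaussianPDFReal_nonneg (-(s ^ 2 / 2)) (s ^ 2).toNNReal x
    exact le_mul_of_one_le_right this (Real.one_le_exp hx.le)
  rw [e1, e2, integral_comp_neg_Iic, neg_zero, hIoi]
  ring

/-! ### The optimal scaling -/

/-- The sign of the derivative of `u ^ 2 * Phi (-u)`. -/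
def effSlope (u : ℝ) : ℝ := 2 * Phi (-u) - u * gaussianPDFReal 0 1 u

lemma hasDerivAt_Phi_neg (u : ℝ) :
    HasDerivAt (fun u => Phi (-u)) (-gaussianPDFReal 0 1 u) u := by
  have h1 := (hasDerivAt_Phi (-u)).comp u (hasDerivAt_neg u)
  have h2 : gaussianPDFReal 0 1 (-u) = gaussianPDFReal 0 1 u := by simp [gaussianPDFReal_std]
  rw [h2, mul_neg_one] at h1
  exact h1

lemma hasDerivAt_gaussianPDFReal_std (u : ℝ) :
    HasDerivAt (gaussianPDFReal 0 1) (-u * gaussianPDFReal 0 1 u) u := by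
  rw [funext gaussianPDFReal_std]
  have h1 : HasDerivAt (fun x : ℝ => -(x ^ 2 / 2)) (-u) u := by
    have := ((hasDerivAt_pow 2 u).div_const 2).neg
    refine this.congr_deriv ?_
    simp
  exact (h1.exp.const_mul _).congr_deriv (by ring)

lemma hasDerivAt_effSlope (u : ℝ) :
    HasDerivAt effSlope ((u ^ 2 - 3) * gaussianPDFReal 0 1 u) u :=
  (((hasDerivAt_Phi_neg u).const_mul 2).fun_sub
    ((hasDerivAt_id' u).fun_mul (hasDerivAt_gaussianPDFReal_std u))).congr_deriv (by ring)

lemma continuous_effSlope : Continuous effSlope :=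
  continuous_iff_continuousAt.2 fun u => (hasDerivAt_effSlope u).continuousAt

lemma strictAntiOn_effSlope : StrictAntiOn effSlope (Icc 0 √3) := by
  refine strictAntiOn_of_deriv_neg (convex_Icc _ _) continuous_effSlope.continuousOn fun u hu => ?_
  rw [interior_Icc] at hu
  rw [(hasDerivAt_effSlope u).deriv]
  have : u ^ 2 < 3 := by
    rw [← Real.sq_sqrt (show (0 : ℝ) ≤ 3 by norm_num)]
    exact pow_lt_pow_left₀ hu.2 hu.1.le two_ne_zero
  exact mul_neg_of_neg_of_pos (by linarith) (gaussianPDFReal_pos 0 1 u one_ne_zero)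

lemma strictMonoOn_effSlope : StrictMonoOn effSlope (Ici √3) := by
  refine strictMonoOn_of_deriv_pos (convex_Ici _) continuous_effSlope.continuousOn fun u hu => ?_
  rw [interior_Ici, mem_Ioi] at hu
  rw [(hasDerivAt_effSlope u).deriv]
  have : 3 < u ^ 2 := by
    rw [← Real.sq_sqrt (show (0 : ℝ) ≤ 3 by norm_num)]
    exact pow_lt_pow_left₀ hu (by positivity) two_ne_zero
  exact mul_pos (by linarith) (gaussianPDFReal_pos 0 1 u one_ne_zero)

lemma tendsto_effSlope : Tendsto effSlope atTop (𝓝 0) := by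
  have h1 : Tendsto (fun u => 2 * Phi (-u)) atTop (𝓝 (2 * 0)) :=
    ((tendsto_cdf_atBot (gaussianReal 0 1)).comp tendsto_neg_atTop_atBot).const_mul 2
  have h2 : Tendsto (fun u : ℝ => u * gaussianPDFReal 0 1 u) atTop (𝓝 0) := by
    have h3 := (tendsto_rpow_mul_exp_neg_mul_atTop_nhds_zero 1 (1 / 2) (by norm_num)).const_mul
      ((√(2 * π))⁻¹)
    rw [mul_zero] at h3
    refine squeeze_zero' ?_ ?_ h3
    · filter_upwards [eventually_ge_atTop 0] with u hu
      exact mul_nonneg hu (gaussianPDFReal_nonneg _ _ _)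
    · filter_upwards [eventually_ge_atTop 1] with u hu
      rw [gaussianPDFReal_std, Real.rpow_one, mul_left_comm]
      have : -(u ^ 2 / 2) ≤ -(1 / 2) * u := by nlinarith
      gcongr
  have h4 := h1.sub h2
  rw [mul_zero, sub_zero] at h4
  exact h4

/-- Beyond `√3` the function increases strictly to its limit `0`, so it stays below it. -/
lemma effSlope_neg_of_sqrt_three_le {u : ℝ} (hu : √3 ≤ u) : effSlope u < 0 := by
  have h1 : effSlope u < effSlope (u + 1) :=
    strictMonoOn_effSlope hu (mem_Ici.2 (by linarith)) (by linarith)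
  refine h1.trans_le (ge_of_tendsto tendsto_effSlope ?_)
  filter_upwards [eventually_ge_atTop (u + 1)] with v hv
  exact strictMonoOn_effSlope.monotoneOn (mem_Ici.2 (by linarith)) (mem_Ici.2 (by linarith)) hv

/-! ### Numerical location of the optimum -/

/-- Taylor bounds for `exp (-(x ^ 2 / 2))`. -/
lemma abs_exp_neg_half_sq_sub_le {x : ℝ} (h0 : 0 ≤ x) (h1 : x ≤ 6 / 5) :
    |exp (-(x ^ 2 / 2)) - (1 - x ^ 2 / 2 + x ^ 4 / 8 - x ^ 6 / 48 + x ^ 8 / 384 - x ^ 10 / 3840 + x ^ 12 / 46080 - x ^ 14 / 645120)|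
      ≤ x ^ 16 / 9175040 := by
  have hx : |-(x ^ 2 / 2)| ≤ 1 := by
    rw [abs_neg, abs_of_nonneg (by positivity)]
    nlinarith
  -- The range `x ≤ 6 / 5` keeps `x ^ 2 / 2` below `1`. The remainder constant is `9 / (8! * 8)`
  -- divided by `2 ^ 8`, that is `1 / 9175040`.
  have := Real.exp_bound hx (n := 8) (by norm_num)
  rw [abs_neg, abs_of_nonneg (by positivity : 0 ≤ x ^ 2 / 2)] at this
  simp only [Finset.sum_range_succ, Finset.sum_range_zero, Nat.factorial] at this
  norm_num at this
  refine le_trans (le_of_eq ?_) (this.trans ?_)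
  · congr 1; ring
  · have : 0 ≤ x ^ 16 := by positivity
    ring_nf
    linarith

lemma abs_integral_exp_neg_half_sq_sub_le {u : ℝ} (h0 : 0 ≤ u) (h1 : u ≤ 6 / 5) :
    |(∫ x in (0 : ℝ)..u, exp (-(x ^ 2 / 2))) -
      (u - u ^ 3 / 6 + u ^ 5 / 40 - u ^ 7 / 336 + u ^ 9 / 3456 - u ^ 11 / 42240 + u ^ 13 / 599040 - u ^ 15 / 9676800)|
      ≤ u ^ 17 / 155975680 := by
  have hP : ∫ x in (0 : ℝ)..u,
      (1 - x ^ 2 / 2 + x ^ 4 / 8 - x ^ 6 / 48 + x ^ 8 / 384 - x ^ 10 / 3840 + x ^ 12 / 46080 - x ^ 14 / 645120) =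
      u - u ^ 3 / 6 + u ^ 5 / 40 - u ^ 7 / 336 + u ^ 9 / 3456 - u ^ 11 / 42240 + u ^ 13 / 599040 - u ^ 15 / 9676800 := by
    have hd : ∀ x ∈ uIcc 0 u, HasDerivAt (fun u : ℝ =>
        u - u ^ 3 / 6 + u ^ 5 / 40 - u ^ 7 / 336 + u ^ 9 / 3456 - u ^ 11 / 42240 + u ^ 13 / 599040 - u ^ 15 / 9676800)
        (1 - x ^ 2 / 2 + x ^ 4 / 8 - x ^ 6 / 48 + x ^ 8 / 384 - x ^ 10 / 3840 + x ^ 12 / 46080 - x ^ 14 / 645120) x := by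
      intro x _
      have e := fun n : ℕ => hasDerivAt_pow n x
      exact ((((((((hasDerivAt_id' x).fun_sub ((e 3).div_const 6)).fun_add
        ((e 5).div_const 40)).fun_sub ((e 7).div_const 336)).fun_add
        ((e 9).div_const 3456)).fun_sub ((e 11).div_const 42240)).fun_add
        ((e 13).div_const 599040)).fun_sub ((e 15).div_const 9676800)).congr_deriv
        (by push_cast; ring)
    rw [intervalIntegral.integral_eq_sub_of_hasDerivAt hd
      (Continuous.intervalIntegrable (by fun_prop) _ _)]
    simp
  have hE : ∫ x in (0 : ℝ)..u, x ^ 16 / 9175040 = u ^ 17 / 155975680 := by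
    rw [intervalIntegral.integral_div, integral_pow]
    norm_num
    ring
  rw [← hP, ← intervalIntegral.integral_sub (Continuous.intervalIntegrable (by fun_prop) _ _)
    (Continuous.intervalIntegrable (by fun_prop) _ _), ← hE]
  refine (intervalIntegral.abs_integral_le_integral_abs h0).trans ?_
  refine intervalIntegral.integral_mono_on h0 (Continuous.intervalIntegrable (by fun_prop) _ _)
    (Continuous.intervalIntegrable (by fun_prop) _ _) fun x hx => ?_
  exact abs_exp_neg_half_sq_sub_le hx.1 (hx.2.trans h1)

lemma sqrt_two_pi_bounds : 2.5065 < √(2 * π) ∧ √(2 * π) < 2.5067 := by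
  have h1 := Real.pi_gt_d4
  have h2 := Real.pi_lt_d4
  constructor
  · apply Real.lt_sqrt_of_sq_lt; norm_num at *; linarith
  · rw [Real.sqrt_lt' (by norm_num)]; norm_num at *; linarith

/-- With the positive factor taken out, the sign depends only on `√(2 * π)`, an integral over `[0,
u]` and one exponential, each enclosed by the bounds above. -/
lemma effSlope_eq (u : ℝ) : effSlope u = (√(2 * π))⁻¹ *
    (√(2 * π) - 2 * (∫ x in (0 : ℝ)..u, exp (-(x ^ 2 / 2))) - u * exp (-(u ^ 2 / 2))) := by
  have h1 := Phi_sub_Phi (-u) 0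
  have h2 : ∫ x in (-u)..0, gaussianPDFReal 0 1 x
      = (√(2 * π))⁻¹ * ∫ x in (0 : ℝ)..u, exp (-(x ^ 2 / 2)) := by
    have := intervalIntegral.integral_comp_neg (a := 0) (b := u) (gaussianPDFReal 0 1)
    rw [neg_zero] at this
    rw [← this, ← intervalIntegral.integral_const_mul]
    simp [gaussianPDFReal_std]
  have h3 : 0 < √(2 * π) := by positivity
  rw [h2, Phi_zero] at h1
  rw [effSlope, gaussianPDFReal_std]
  have h4 : Phi (-u) = 1 / 2 - (√(2 * π))⁻¹ * ∫ x in (0 : ℝ)..u, exp (-(x ^ 2 / 2)) := by linarith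
  rw [h4]
  field_simp

lemma effSlope_pos_at : 0 < effSlope 1.185 := by
  have h1 := (abs_le.1 (abs_exp_neg_half_sq_sub_le (x := 1.185) (by norm_num) (by norm_num))).2
  have h2 :=
    (abs_le.1 (abs_integral_exp_neg_half_sq_sub_le (u := 1.185) (by norm_num) (by norm_num))).2
  have h3 := sqrt_two_pi_bounds
  rw [effSlope_eq]
  refine mul_pos (by positivity) ?_
  norm_num at *
  linarith

lemma effSlope_neg_at : effSlope 1.193 < 0 := by
  have h1 := (abs_le.1 (abs_exp_neg_half_sq_sub_le (x := 1.193) (by norm_num) (by norm_num))).1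
  have h2 :=
    (abs_le.1 (abs_integral_exp_neg_half_sq_sub_le (u := 1.193) (by norm_num) (by norm_num))).1
  have h3 := sqrt_two_pi_bounds
  rw [effSlope_eq]
  refine mul_neg_of_pos_of_neg (by positivity) ?_
  norm_num at *
  linarith

/-- At a zero of `effSlope` the value `2 * Phi (-u)` equals `u` times the normal density. That
product decreases for `u ≥ 1`, so its values at the two endpoints enclose it. -/
lemma two_mul_Phi_neg_bounds {u : ℝ} (h₁ : 1.185 < u) (h₂ : u < 1.193) (hu : effSlope u = 0) :
    0.2335 ≤ 2 * Phi (-u) ∧ 2 * Phi (-u) < 0.2345 := by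
  have h0 : 2 * Phi (-u) = u * gaussianPDFReal 0 1 u := by rw [effSlope] at hu; linarith
  have hanti : StrictAntiOn (fun u => u * gaussianPDFReal 0 1 u) (Ici 1) := by
    have hd : ∀ u, HasDerivAt (fun u => u * gaussianPDFReal 0 1 u)
        ((1 - u ^ 2) * gaussianPDFReal 0 1 u) u := fun u =>
      ((hasDerivAt_id' u).fun_mul (hasDerivAt_gaussianPDFReal_std u)).congr_deriv (by ring)
    refine strictAntiOn_of_deriv_neg (convex_Ici _)
      (fun u _ => (hd u).continuousAt.continuousWithinAt) fun u hu => ?_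
    rw [interior_Ici, mem_Ioi] at hu
    rw [(hd u).deriv]
    exact mul_neg_of_neg_of_pos (by nlinarith) (gaussianPDFReal_pos 0 1 u one_ne_zero)
  norm_num at h₁ h₂
  have hb₁ := hanti (a := 1.185) (b := u) (by norm_num) (mem_Ici.2 (by linarith)) (by norm_num; linarith)
  have hb₂ := hanti (a := u) (b := 1.193) (mem_Ici.2 (by linarith)) (by norm_num) (by norm_num; linarith)
  have e1 := (abs_le.1 (abs_exp_neg_half_sq_sub_le (x := 1.185) (by norm_num) (by norm_num))).2
  have e2 := (abs_le.1 (abs_exp_neg_half_sq_sub_le (x := 1.193) (by norm_num) (by norm_num))).1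
  have h3 := sqrt_two_pi_bounds
  have hs : 0 < √(2 * π) := by positivity
  simp only [gaussianPDFReal_std] at hb₁ hb₂ h0
  rw [h0]
  constructor
  · refine le_trans ?_ hb₂.le
    rw [mul_left_comm, ← div_eq_inv_mul, le_div_iff₀ hs]
    norm_num at *
    linarith
  · refine hb₁.trans_le ?_
    rw [mul_left_comm, ← div_eq_inv_mul, div_le_iff₀ hs]
    norm_num at *
    linarith

lemma exists_effSlope_eq_zero : ∃ u, 1.185 < u ∧ u < 1.193 ∧ effSlope u = 0 := by
  obtain ⟨u, hu, h0⟩ := intermediate_value_Icc' (by norm_num : (1.185 : ℝ) ≤ 1.193)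
    continuous_effSlope.continuousOn ⟨effSlope_neg_at.le, effSlope_pos_at.le⟩
  refine ⟨u, hu.1.lt_of_ne ?_, hu.2.lt_of_ne ?_, h0⟩
  · rintro rfl; exact effSlope_pos_at.ne' h0
  · rintro rfl; exact effSlope_neg_at.ne h0

lemma hasDerivAt_sq_mul_Phi_neg (u : ℝ) :
    HasDerivAt (fun u => u ^ 2 * Phi (-u)) (u * effSlope u) u :=
  ((hasDerivAt_pow 2 u).fun_mul (hasDerivAt_Phi_neg u)).congr_deriv (by
    rw [effSlope]; push_cast; ring)

/-- The function `u ^ 2 * Phi (-u)` has a strict global maximum on the positive axis. -/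
lemma exists_strict_max_sq_mul_Phi_neg : ∃ u₀ : ℝ, 0 < u₀ ∧
    (∀ u, 0 < u → u ≠ u₀ → u ^ 2 * Phi (-u) < u₀ ^ 2 * Phi (-u₀)) ∧
    0.2335 ≤ 2 * Phi (-u₀) ∧ 2 * Phi (-u₀) < 0.2345 := by
  obtain ⟨u₀, h1, h2, h0⟩ := exists_effSlope_eq_zero
  refine ⟨u₀, by norm_num at h1; linarith, ?_, two_mul_Phi_neg_bounds h1 h2 h0⟩
  norm_num at h1 h2
  have h3 : u₀ < √3 := by
    refine h2.trans ?_
    apply Real.lt_sqrt_of_sq_lt; norm_num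
  have hc : Continuous fun u => u ^ 2 * Phi (-u) :=
    continuous_iff_continuousAt.2 fun u => (hasDerivAt_sq_mul_Phi_neg u).continuousAt
  have hm : StrictMonoOn (fun u => u ^ 2 * Phi (-u)) (Icc 0 u₀) := by
    refine strictMonoOn_of_deriv_pos (convex_Icc _ _) hc.continuousOn fun u hu => ?_
    rw [interior_Icc] at hu
    rw [(hasDerivAt_sq_mul_Phi_neg u).deriv, ← mul_zero u, ← h0]
    exact mul_lt_mul_of_pos_left (strictAntiOn_effSlope ⟨hu.1.le, (hu.2.trans h3).le⟩
      ⟨by linarith, h3.le⟩ hu.2) hu.1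
  have ha : StrictAntiOn (fun u => u ^ 2 * Phi (-u)) (Ici u₀) := by
    refine strictAntiOn_of_deriv_neg (convex_Ici _) hc.continuousOn fun u hu => ?_
    rw [interior_Ici, mem_Ioi] at hu
    rw [(hasDerivAt_sq_mul_Phi_neg u).deriv]
    refine mul_neg_of_pos_of_neg (by linarith) ?_
    rcases le_total √3 u with h | h
    · exact effSlope_neg_of_sqrt_three_le h
    · rw [← h0]
      exact strictAntiOn_effSlope ⟨by linarith, h3.le⟩ ⟨by linarith, h⟩ hu
  intro u hu hne
  rcases lt_or_gt_of_ne hne with h | h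
  · exact hm ⟨hu.le, h.le⟩ ⟨by linarith, le_rfl⟩ h
  · exact ha (mem_Ici.2 le_rfl) h.le h

lemma limitEff_eq_of_pos {f : ℝ → ℝ} {m b : ℝ} (hJ : 0 < J f m b) (ℓ : ℝ) :
    limitEff f m b ℓ = 2 / (√(J f m b) / √2) ^ 2 *
      ((ℓ * (√(J f m b) / √2)) ^ 2 * Phi (-(ℓ * (√(J f m b) / √2)))) := by
  have h1 : 0 < √(J f m b) := Real.sqrt_pos.2 hJ
  have h2 : 0 < √(2 : ℝ) := by positivity
  have h3 : -(ℓ * √(J f m b)) / √2 = -(ℓ * (√(J f m b) / √2)) := by ring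
  rw [limitEff, h3]
  field_simp

/-- The limiting efficiency has exactly one maximiser, at which the acceptance rate is `0.234`. -/
lemma exists_maximiser_limitEff {f : ℝ → ℝ} {m b : ℝ} (hJ : 0 < J f m b) :
    ∃ ℓ₀ : ℝ, 0 < ℓ₀ ∧ IsMaxOn (limitEff f m b) (Ioi 0) ℓ₀ ∧
      (∀ ℓ, 0 < ℓ → IsMaxOn (limitEff f m b) (Ioi 0) ℓ → ℓ = ℓ₀) ∧
      0.2335 ≤ 2 * Phi (-(ℓ₀ * √(J f m b)) / √2) ∧ 2 * Phi (-(ℓ₀ * √(J f m b)) / √2) < 0.2345 := by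
  obtain ⟨u₀, hu₀, hmax, hb⟩ := exists_strict_max_sq_mul_Phi_neg
  set c := √(J f m b) / √2 with hc
  have hc0 : 0 < c := div_pos (Real.sqrt_pos.2 hJ) (by positivity)
  have key : ∀ ℓ, 0 < ℓ → ℓ ≠ u₀ / c → limitEff f m b ℓ < limitEff f m b (u₀ / c) := by
    intro ℓ hℓ hne
    rw [limitEff_eq_of_pos hJ, limitEff_eq_of_pos hJ, ← hc, div_mul_cancel₀ _ hc0.ne']
    refine mul_lt_mul_of_pos_left (hmax _ (by positivity) ?_) (by positivity)
    rwa [ne_eq, ← eq_div_iff hc0.ne']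
  have h0 : 0 < u₀ / c := by positivity
  refine ⟨u₀ / c, h0, fun ℓ hℓ => ?_, fun ℓ hℓ hm => ?_, ?_⟩
  · rcases eq_or_ne ℓ (u₀ / c) with rfl | hne
    · exact le_refl (limitEff f m b _)
    · exact (key ℓ hℓ hne).le
  · by_contra hne
    exact (key ℓ hℓ hne).not_ge (hm h0)
  · have h3 : -(u₀ / c * √(J f m b)) / √2 = -u₀ := by
      have : u₀ / c * c = u₀ := div_mul_cancel₀ _ hc0.ne'
      rw [hc] at this ⊢
      linear_combination -this
    rwa [h3]

/-- Here `Phi 0 = 1 / 2`, so the limit is `ℓ ^ 2`, which is strictly increasing. -/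
lemma not_isMaxOn_limitEff_of_J_eq_zero {f : ℝ → ℝ} {m b : ℝ} (hJ : J f m b = 0) :
    ¬ ∃ ℓ : ℝ, 0 < ℓ ∧ IsMaxOn (limitEff f m b) (Ioi 0) ℓ := by
  rintro ⟨ℓ, hℓ, hm⟩
  have h1 : limitEff f m b (ℓ + 1) ≤ limitEff f m b ℓ := hm (mem_Ioi.2 (by linarith))
  simp only [limitEff, hJ, Real.sqrt_zero, mul_zero, neg_zero, zero_div, Phi_zero] at h1
  nlinarith

/-! ### A second-order Peano expansion -/

/-- `F'` is differentiable only at `0`, and the values are complex. The mean value inequality is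
therefore applied to `F y - c / 2 * y ^ 2` on the ball of radius `|ε|`, where its derivative is at
most a small multiple of `|ε|`. -/
lemma tendsto_div_sq_of_hasDerivAt {F F' : ℝ → ℂ} {c : ℂ}
    (hF : ∀ᶠ ε in 𝓝 (0 : ℝ), HasDerivAt F (F' ε) ε) (hF' : HasDerivAt F' c 0) (h0 : F 0 = 0)
    (h0' : F' 0 = 0) : Tendsto (fun ε : ℝ => F ε / (ε : ℂ) ^ 2) (𝓝[≠] 0) (𝓝 (c / 2)) := by
  rw [Metric.tendsto_nhdsWithin_nhds]
  intro η hη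
  have h1 := (hasDerivAt_iff_isLittleO.1 hF').def (half_pos hη)
  obtain ⟨δ, hδ, hball⟩ := Metric.eventually_nhds_iff_ball.1 (hF.and h1)
  refine ⟨δ, hδ, fun {ε} hne hε => ?_⟩
  have hne : ε ≠ 0 := hne
  have hneC : (ε : ℂ) ≠ 0 := by exact_mod_cast hne
  have hd : ∀ y ∈ Metric.closedBall (0 : ℝ) |ε|, HasDerivWithinAt
      (fun y : ℝ => F y - c / 2 * (y : ℂ) ^ 2) (F' y - c * y) (Metric.closedBall 0 |ε|) y := by
    intro y hy
    have hy' : y ∈ Metric.ball (0 : ℝ) δ := by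
      simp only [Metric.mem_closedBall, Metric.mem_ball, dist_zero_right, Real.norm_eq_abs] at *
      exact hy.trans_lt hε
    have e1 : HasDerivAt (fun y : ℝ => (y : ℂ) ^ 2) (2 * y) y := by
      have := (HasDerivAt.ofReal_comp (hasDerivAt_id' y)).pow 2
      exact this.congr_deriv (by simp)
    exact (((hball y hy').1.fun_sub (e1.const_mul (c / 2))).congr_deriv (by ring)).hasDerivWithinAt
  have hb : ∀ y ∈ Metric.closedBall (0 : ℝ) |ε|, ‖F' y - c * y‖ ≤ η / 2 * |ε| := by
    intro y hy
    have hy1 : |y| ≤ |ε| := by simpa using hy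
    have hy' : y ∈ Metric.ball (0 : ℝ) δ := by
      simp only [Metric.mem_ball, dist_zero_right, Real.norm_eq_abs] at *
      exact hy1.trans_lt hε
    have := (hball y hy').2
    simp only [h0', sub_zero, Real.norm_eq_abs, Complex.real_smul] at this
    rw [mul_comm c]
    exact this.trans (by gcongr)
  have key := (convex_closedBall (0 : ℝ) |ε|).norm_image_sub_le_of_norm_hasDerivWithin_le hd hb
    (x := 0) (y := ε) (by simp) (by simp)
  simp only [h0, Complex.ofReal_zero, sub_zero, Real.norm_eq_abs] at key
  rw [dist_eq_norm]
  have e2 : F ε / (ε : ℂ) ^ 2 - c / 2 = (F ε - c / 2 * (ε : ℂ) ^ 2) / (ε : ℂ) ^ 2 := by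
    field_simp
  have hpos : 0 < |ε| := abs_pos.2 hne
  rw [e2, norm_div, norm_pow, Complex.norm_real, Real.norm_eq_abs, div_lt_iff₀ (by positivity)]
  have e3 : ‖F ε - c / 2 * (ε : ℂ) ^ 2‖ ≤ η / 2 * |ε| * |ε| := by simpa using key
  nlinarith [mul_pos hη (mul_pos hpos hpos)]

/-! ### The one-dimensional swap -/

/-- The coordinate map of `rescale` from level `b` to level `b + ε`. -/
def scaleMap (m b ε x : ℝ) : ℝ := √(b / (b + ε)) * (x - m) + m

/-- The one-dimensional contribution of the cold state to the log acceptance ratio. -/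
def logRatio (f : ℝ → ℝ) (m b ε x : ℝ) : ℝ :=
  (b + ε) * h f (scaleMap m b ε x) - b * h f x

/-- The integrand of the unnormalised complex moment generating function of `logRatio`. -/
def mgfIntegrand (f : ℝ → ℝ) (m b : ℝ) (z : ℂ) (ε x : ℝ) : ℂ :=
  Complex.exp (z * logRatio f m b ε x) * (exp (b * h f x) : ℝ)

/-- The derivative of `ε ↦ score (scaleMap ε x)`. -/
def scoreSlope (f : ℝ → ℝ) (m b ε x : ℝ) : ℝ :=
  (r f m (scaleMap m b ε x) - k f m (scaleMap m b ε x)) / (4 * (b + ε))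

section Expansion

variable {f : ℝ → ℝ} (hφ : Tame (h f)) {m b : ℝ}

lemma abs_lt_half_iff {ε : ℝ} (hε : |ε| < b / 2) : b / 2 < b + ε ∧ b + ε < 2 * b := by
  have := abs_lt.1 hε
  constructor <;> linarith [abs_nonneg ε]

/-- Confining `ε` to `|ε| < b / 2` makes the dilations uniformly bi-Lipschitz, so growth and decay
estimates transfer through `scaleMap` with constants independent of `ε`. -/
lemma sqrt_ratio_bounds {ε : ℝ} (hε : |ε| < b / 2) :
    1 / 2 ≤ √(b / (b + ε)) ∧ √(b / (b + ε)) ≤ 2 := by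
  obtain ⟨h1, h2⟩ := abs_lt_half_iff hε
  have hb : 0 < b := by linarith [abs_nonneg ε]
  constructor
  · apply Real.le_sqrt_of_sq_le
    rw [le_div_iff₀ (by linarith)]
    linarith
  · rw [Real.sqrt_le_left (by norm_num), div_le_iff₀ (by linarith)]
    linarith

lemma one_add_abs_scaleMap_le {ε : ℝ} (hε : |ε| < b / 2) (x : ℝ) :
    1 + |scaleMap m b ε x| ≤ (2 + 3 * |m|) * (1 + |x|) := by
  obtain ⟨-, h2⟩ := sqrt_ratio_bounds hε
  have h3 : |scaleMap m b ε x| ≤ 2 * (|x| + |m|) + |m| := by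
    unfold scaleMap
    refine (abs_add_le _ _).trans (add_le_add_left ?_ _)
    rw [abs_mul, abs_of_nonneg (Real.sqrt_nonneg _)]
    gcongr
    exact abs_sub _ _
  nlinarith [abs_nonneg x, abs_nonneg m, mul_nonneg (abs_nonneg x) (abs_nonneg m)]

lemma one_add_abs_le_scaleMap {ε : ℝ} (hε : |ε| < b / 2) (x : ℝ) :
    1 + |x| ≤ (2 + 3 * |m|) * (1 + |scaleMap m b ε x|) := by
  obtain ⟨h1, -⟩ := sqrt_ratio_bounds hε
  have h3 : |x - m| ≤ 2 * (|scaleMap m b ε x| + |m|) := by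
    have e1 : √(b / (b + ε)) * |x - m| = |scaleMap m b ε x - m| := by
      rw [scaleMap, add_sub_cancel_right, abs_mul, abs_of_nonneg (Real.sqrt_nonneg _)]
    have e2 := abs_sub (scaleMap m b ε x) m
    rw [← e1] at e2
    nlinarith [abs_nonneg (x - m)]
  have h4 : |x| ≤ |x - m| + |m| := by
    have := abs_add_le (x - m) m
    simpa using this
  nlinarith [abs_nonneg (scaleMap m b ε x), abs_nonneg m,
    mul_nonneg (abs_nonneg (scaleMap m b ε x)) (abs_nonneg m)]

lemma PolyGrowth.comp_scaleMap {u : ℝ → ℝ} (hu : PolyGrowth u) (m b : ℝ) :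
    ∃ C : ℝ, ∃ n : ℕ, 0 ≤ C ∧ ∀ ε, |ε| < b / 2 → ∀ x, |u (scaleMap m b ε x)| ≤ C * (1 + |x|) ^ n := by
  obtain ⟨C, n, hC, hu⟩ := hu
  refine ⟨C * (2 + 3 * |m|) ^ n, n, by positivity, fun ε hε x => (hu _).trans ?_⟩
  rw [mul_assoc, ← mul_pow]
  gcongr
  exact one_add_abs_scaleMap_le hε x

lemma hasDerivAt_scaleMap {ε : ℝ} (hε : |ε| < b / 2) (x : ℝ) :
    HasDerivAt (fun ε => scaleMap m b ε x) (-(scaleMap m b ε x - m) / (2 * (b + ε))) ε := by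
  obtain ⟨h1, -⟩ := abs_lt_half_iff hε
  have hb : 0 < b := by linarith [abs_nonneg ε]
  have hbε : 0 < b + ε := by linarith
  have e1 : HasDerivAt (fun ε => b / (b + ε)) (-b / (b + ε) ^ 2) ε := by
    have := ((hasDerivAt_id' ε).const_add b).inv hbε.ne'
    exact (this.const_mul b).congr_deriv (by ring)
  have e2 := ((e1.sqrt (div_pos hb hbε).ne').mul_const (x - m)).add_const m
  refine e2.congr_deriv ?_
  rw [scaleMap, add_sub_cancel_right]
  have hs : √(b / (b + ε)) ≠ 0 := (Real.sqrt_pos.2 (div_pos hb hbε)).ne'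
  have hs2 : √(b / (b + ε)) ^ 2 = b / (b + ε) := Real.sq_sqrt (div_pos hb hbε).le
  rw [div_mul_eq_mul_div, div_eq_div_iff (by positivity) (by positivity)]
  have hs3 : √(b / (b + ε)) ^ 2 * (b + ε) = b := by rw [hs2, div_mul_cancel₀ _ hbε.ne']
  field_simp
  linear_combination (x - m) * hs3

include hφ in
-- The factor `b + ε` cancels the denominator in the derivative of `scaleMap`, so the derivative
-- depends on `ε` only through `scaleMap`. This is where `score` comes from.
lemma hasDerivAt_logRatio {ε : ℝ} (hε : |ε| < b / 2) (x : ℝ) :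
    HasDerivAt (fun ε => logRatio f m b ε x) (score f m (scaleMap m b ε x)) ε := by
  obtain ⟨h1, -⟩ := abs_lt_half_iff hε
  have hbε : b + ε ≠ 0 := by linarith [abs_nonneg ε]
  have e1 := (hasDerivAt_h hφ (scaleMap m b ε x)).comp ε (hasDerivAt_scaleMap hε x)
  refine ((((hasDerivAt_id' ε).const_add b).fun_mul e1).sub_const (b * h f x)).congr_deriv ?_
  simp only [score, k, Function.comp_apply]
  field_simp
  ring

include hφ in
lemma hasDerivAt_score (x : ℝ) : HasDerivAt (score f m) ((deriv (h f) x -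
    (x - m) * iteratedDeriv 2 (h f) x) / 2) x := by
  have h0 := ((hasDerivAt_id' x).sub_const m).fun_mul (hasDerivAt_deriv_h hφ x)
  exact ((hasDerivAt_h hφ x).fun_sub (h0.div_const 2)).congr_deriv (by ring)

include hφ in
lemma hasDerivAt_score_scaleMap {ε : ℝ} (hε : |ε| < b / 2) (x : ℝ) :
    HasDerivAt (fun ε => score f m (scaleMap m b ε x)) (scoreSlope f m b ε x) ε := by
  obtain ⟨h1, -⟩ := abs_lt_half_iff hε
  have hbε : b + ε ≠ 0 := by linarith [abs_nonneg ε]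
  refine ((hasDerivAt_score hφ _).comp ε (hasDerivAt_scaleMap hε x)).congr_deriv ?_
  rw [scoreSlope, r, k]
  field_simp
  ring

include hφ in
lemma hasDerivAt_mgfIntegrand (z : ℂ) {ε : ℝ} (hε : |ε| < b / 2) (x : ℝ) :
    HasDerivAt (fun ε => mgfIntegrand f m b z ε x)
      (z * (score f m (scaleMap m b ε x) : ℝ) * mgfIntegrand f m b z ε x) ε := by
  have e1 := ((hasDerivAt_logRatio hφ hε x (m := m)).ofReal_comp.const_mul z).cexp.mul_const
    ((exp (b * h f x) : ℝ) : ℂ)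
  exact e1.congr_deriv (by rw [mgfIntegrand]; ring)

include hφ in
lemma hasDerivAt_score_mul_mgfIntegrand (z : ℂ) {ε : ℝ} (hε : |ε| < b / 2) (x : ℝ) :
    HasDerivAt (fun ε => z * (score f m (scaleMap m b ε x) : ℝ) * mgfIntegrand f m b z ε x)
      ((z * (scoreSlope f m b ε x : ℝ) + z ^ 2 * (score f m (scaleMap m b ε x) : ℝ) ^ 2) *
        mgfIntegrand f m b z ε x) ε := by
  have e1 := (hasDerivAt_score_scaleMap hφ hε x (m := m)).ofReal_comp.const_mul z
  exact (e1.fun_mul (hasDerivAt_mgfIntegrand hφ z hε x)).congr_deriv (by ring)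

lemma continuous_scaleMap (ε : ℝ) : Continuous (scaleMap m b ε) := by
  unfold scaleMap
  fun_prop

include hφ in
lemma continuous_logRatio (ε : ℝ) : Continuous (logRatio f m b ε) := by
  have := hφ.contDiff.continuous
  have := continuous_scaleMap (m := m) (b := b) ε
  unfold logRatio
  fun_prop

include hφ in
lemma continuous_mgfIntegrand (z : ℂ) (ε : ℝ) : Continuous (mgfIntegrand f m b z ε) := by
  have := hφ.contDiff.continuous
  have := continuous_logRatio hφ (m := m) (b := b) ε
  unfold mgfIntegrand
  fun_prop

include hφ in
lemma continuous_score_scaleMap (ε : ℝ) : Continuous fun x => score f m (scaleMap m b ε x) :=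
  (continuous_score hφ m).comp (continuous_scaleMap ε)

include hφ in
lemma continuous_scoreSlope (ε : ℝ) : Continuous (scoreSlope f m b ε) := by
  have h1 := (continuous_r hφ m).comp (continuous_scaleMap (m := m) (b := b) ε)
  have h2 := (continuous_k hφ m).comp (continuous_scaleMap (m := m) (b := b) ε)
  exact (h1.sub h2).div_const _

/-- The exponents in use, `0`, `it`, `1` and `1 - it`, have real part `0` or `1`. The modulus is
then the cold weight, or the hot weight at the scaled point, and both decay rapidly. -/
lemma norm_mgfIntegrand_of_re_eq_zero {z : ℂ} (hz : z.re = 0) (ε x : ℝ) :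
    ‖mgfIntegrand f m b z ε x‖ = exp (b * h f x) := by
  rw [mgfIntegrand, norm_mul, Complex.norm_exp, Complex.norm_real, Real.norm_eq_abs,
    abs_of_pos (exp_pos _)]
  simp [hz]

lemma norm_mgfIntegrand_of_re_eq_one {z : ℂ} (hz : z.re = 1) (ε x : ℝ) :
    ‖mgfIntegrand f m b z ε x‖ = exp ((b + ε) * h f (scaleMap m b ε x)) := by
  rw [mgfIntegrand, norm_mul, Complex.norm_exp, Complex.norm_real, Real.norm_eq_abs,
    abs_of_pos (exp_pos _), ← Real.exp_add]
  simp [hz, logRatio]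

include hφ in
lemma exists_bound_mgfIntegrand (hb : 0 < b) {z : ℂ} (hz : z.re = 0 ∨ z.re = 1) (n : ℕ) :
    ∃ C : ℝ, 0 ≤ C ∧ ∀ ε, |ε| < b / 2 → ∀ x, (1 + |x|) ^ n * ‖mgfIntegrand f m b z ε x‖ ≤ C := by
  rcases hz with hz | hz
  · obtain ⟨C, hC⟩ := hφ.decay b hb n
    refine ⟨C, le_trans (by positivity) (hC 0), fun ε _ x => ?_⟩
    rw [norm_mgfIntegrand_of_re_eq_zero hz]
    exact hC x
  · obtain ⟨C, hC⟩ := hφ.decay (b / 2) (by linarith) n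
    obtain ⟨K, hK⟩ := hφ.decay 1 one_pos 0
    simp only [pow_zero, one_mul] at hK
    have hK0 : 0 < K := (exp_pos _).trans_le (hK 0)
    have hφK : ∀ x, h f x ≤ |log K| := fun x =>
      ((Real.le_log_iff_exp_le hK0).2 (hK x)).trans (le_abs_self _)
    have hC0 : 0 ≤ C := le_trans (by positivity) (hC 0)
    refine ⟨(2 + 3 * |m|) ^ n * (C * exp (2 * b * |log K|)), by positivity, fun ε hε x => ?_⟩
    rw [norm_mgfIntegrand_of_re_eq_one hz]
    obtain ⟨h1, h2⟩ := abs_lt_half_iff hε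
    set y := scaleMap m b ε x with hy
    -- The part `b / 2` of the exponent is kept for decay. The rest has a positive coefficient below
    -- `2 * b` and is bounded because `h` is bounded above.
    have e1 : (b + ε) * h f y ≤ b / 2 * h f y + 2 * b * |log K| := by
      have := hφK y
      nlinarith [abs_nonneg (log K)]
    have e2 : (1 + |x|) ^ n ≤ (2 + 3 * |m|) ^ n * (1 + |y|) ^ n := by
      rw [← mul_pow]
      gcongr
      exact one_add_abs_le_scaleMap hε x
    calc (1 + |x|) ^ n * exp ((b + ε) * h f y)
        ≤ ((2 + 3 * |m|) ^ n * (1 + |y|) ^ n) * (exp (b / 2 * h f y) * exp (2 * b * |log K|)) := by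
          rw [← Real.exp_add]
          gcongr
      _ = (2 + 3 * |m|) ^ n * (((1 + |y|) ^ n * exp (b / 2 * h f y)) * exp (2 * b * |log K|)) := by
          ring
      _ ≤ _ := by
          gcongr
          exact hC y

include hφ in
/-- A uniform integrable bound for polynomially growing multiples of the integrand. -/
lemma exists_integrable_bound (hb : 0 < b) {z : ℂ} (hz : z.re = 0 ∨ z.re = 1)
    {w : ℝ → ℝ → ℂ} (hw : ∃ C : ℝ, ∃ n : ℕ, 0 ≤ C ∧ ∀ ε, |ε| < b / 2 → ∀ x,
      ‖w ε x‖ ≤ C * (1 + |x|) ^ n) :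
    ∃ g : ℝ → ℝ, Integrable g ∧ ∀ ε, |ε| < b / 2 → ∀ x,
      ‖w ε x * mgfIntegrand f m b z ε x‖ ≤ g x := by
  obtain ⟨C, n, hC, hw⟩ := hw
  -- Two spare powers leave the integrable majorant `(1 + |x|)⁻²`.
  obtain ⟨D, hD, hbound⟩ := exists_bound_mgfIntegrand hφ (m := m) hb hz (n + 2)
  refine ⟨fun x => C * D * ((1 + |x|) ^ 2)⁻¹, integrable_inv_one_add_abs_sq.const_mul _,
    fun ε hε x => ?_⟩
  have hx : (0 : ℝ) < (1 + |x|) ^ 2 := by positivity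
  rw [norm_mul]
  beta_reduce
  rw [← div_eq_mul_inv, le_div_iff₀ hx]
  calc ‖w ε x‖ * ‖mgfIntegrand f m b z ε x‖ * (1 + |x|) ^ 2
      ≤ (C * (1 + |x|) ^ n) * ‖mgfIntegrand f m b z ε x‖ * (1 + |x|) ^ 2 := by
        gcongr; exact hw ε hε x
    _ = C * ((1 + |x|) ^ (n + 2) * ‖mgfIntegrand f m b z ε x‖) := by ring
    _ ≤ C * D := by gcongr; exact hbound ε hε x

include hφ in
lemma exists_bound_score (z : ℂ) (m b : ℝ) : ∃ C : ℝ, ∃ n : ℕ, 0 ≤ C ∧ ∀ ε, |ε| < b / 2 → ∀ x,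
    ‖z * (score f m (scaleMap m b ε x) : ℝ)‖ ≤ C * (1 + |x|) ^ n := by
  obtain ⟨C, n, hC, hs⟩ := (polyGrowth_score hφ m).comp_scaleMap m b
  refine ⟨‖z‖ * C, n, by positivity, fun ε hε x => ?_⟩
  rw [norm_mul, Complex.norm_real, Real.norm_eq_abs, mul_assoc]
  gcongr
  exact hs ε hε x

include hφ in
lemma exists_bound_scoreSlope (hb : 0 < b) (z : ℂ) (m : ℝ) :
    ∃ C : ℝ, ∃ n : ℕ, 0 ≤ C ∧ ∀ ε, |ε| < b / 2 → ∀ x,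
      ‖z * (scoreSlope f m b ε x : ℝ) + z ^ 2 * (score f m (scaleMap m b ε x) : ℝ) ^ 2‖
        ≤ C * (1 + |x|) ^ n := by
  have hrk := (polyGrowth_r hφ m).sub (polyGrowth_k hφ m)
  have hsc := (polyGrowth_score hφ m).pow 2
  obtain ⟨C₁, n₁, hC₁, h₁⟩ := hrk.comp_scaleMap m b
  obtain ⟨C₂, n₂, hC₂, h₂⟩ := hsc.comp_scaleMap m b
  refine ⟨‖z‖ * (C₁ / (2 * b)) + ‖z‖ ^ 2 * C₂, n₁ + n₂, by positivity, fun ε hε x => ?_⟩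
  obtain ⟨hε1, -⟩ := abs_lt_half_iff hε
  have hx : (1 : ℝ) ≤ 1 + |x| := by linarith [abs_nonneg x]
  have e1 : |scoreSlope f m b ε x| ≤ C₁ / (2 * b) * (1 + |x|) ^ (n₁ + n₂) := by
    rw [scoreSlope, abs_div, abs_of_pos (by linarith : 0 < 4 * (b + ε)), div_mul_eq_mul_div]
    have : C₁ * (1 + |x|) ^ n₁ ≤ C₁ * (1 + |x|) ^ (n₁ + n₂) :=
      mul_le_mul_of_nonneg_left (pow_le_pow_right₀ hx (by omega)) hC₁
    exact div_le_div₀ (by positivity) ((h₁ ε hε x).trans this) (by positivity) (by linarith)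
  have e2 : |score f m (scaleMap m b ε x) ^ 2| ≤ C₂ * (1 + |x|) ^ (n₁ + n₂) :=
    (h₂ ε hε x).trans (mul_le_mul_of_nonneg_left (pow_le_pow_right₀ hx (by omega)) hC₂)
  refine (norm_add_le _ _).trans ?_
  rw [norm_mul, norm_mul, norm_pow, ← Complex.ofReal_pow, Complex.norm_real, Complex.norm_real,
    Real.norm_eq_abs, Real.norm_eq_abs]
  calc _ ≤ ‖z‖ * (C₁ / (2 * b) * (1 + |x|) ^ (n₁ + n₂)) +
        ‖z‖ ^ 2 * (C₂ * (1 + |x|) ^ (n₁ + n₂)) := by gcongr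
    _ = _ := by ring

/-- The unnormalised complex moment generating function of `logRatio`. -/
def mgfInt (f : ℝ → ℝ) (m b : ℝ) (z : ℂ) (ε : ℝ) : ℂ := ∫ x, mgfIntegrand f m b z ε x

/-- The derivative of `mgfInt`. -/
def mgfIntDeriv (f : ℝ → ℝ) (m b : ℝ) (z : ℂ) (ε : ℝ) : ℂ :=
  ∫ x, z * (score f m (scaleMap m b ε x) : ℝ) * mgfIntegrand f m b z ε x

include hφ in
lemma integrable_mgfIntegrand (hb : 0 < b) {z : ℂ} (hz : z.re = 0 ∨ z.re = 1) {ε : ℝ}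
    (hε : |ε| < b / 2) : Integrable (mgfIntegrand f m b z ε) := by
  obtain ⟨g, hg, hbd⟩ := exists_integrable_bound hφ (m := m) hb hz (w := fun _ _ => 1)
    ⟨1, 0, zero_le_one, fun ε _ x => by simp⟩
  refine hg.mono' (continuous_mgfIntegrand hφ z ε).aestronglyMeasurable
    (Eventually.of_forall fun x => ?_)
  simpa using hbd ε hε x

lemma abs_lt_half_mem_nhds {ε : ℝ} (hε : |ε| < b / 2) : {δ : ℝ | |δ| < b / 2} ∈ 𝓝 ε :=
  (isOpen_lt continuous_abs continuous_const).mem_nhds hε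

include hφ in
lemma hasDerivAt_mgfInt (hb : 0 < b) {z : ℂ} (hz : z.re = 0 ∨ z.re = 1) {ε : ℝ}
    (hε : |ε| < b / 2) : HasDerivAt (mgfInt f m b z) (mgfIntDeriv f m b z ε) ε := by
  obtain ⟨g, hg, hbd⟩ := exists_integrable_bound hφ hb hz (exists_bound_score hφ z m b)
  have hc := continuous_mgfIntegrand hφ (m := m) (b := b) z
  have hs := continuous_score_scaleMap hφ (m := m) (b := b) ε
  exact (hasDerivAt_integral_of_dominated_loc_of_deriv_le (abs_lt_half_mem_nhds hε)
    (Eventually.of_forall fun δ => (hc δ).aestronglyMeasurable)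
    (integrable_mgfIntegrand hφ hb hz hε)
    (Continuous.aestronglyMeasurable (by fun_prop))
    (Eventually.of_forall fun x δ hδ => hbd δ hδ x) hg
    (Eventually.of_forall fun x δ hδ => hasDerivAt_mgfIntegrand hφ z hδ x)).2

include hφ in
lemma hasDerivAt_mgfIntDeriv (hb : 0 < b) {z : ℂ} (hz : z.re = 0 ∨ z.re = 1) {ε : ℝ}
    (hε : |ε| < b / 2) : HasDerivAt (mgfIntDeriv f m b z)
      (∫ x, (z * (scoreSlope f m b ε x : ℝ) + z ^ 2 * (score f m (scaleMap m b ε x) : ℝ) ^ 2) *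
        mgfIntegrand f m b z ε x) ε := by
  obtain ⟨g, hg, hbd⟩ := exists_integrable_bound hφ hb hz (exists_bound_scoreSlope hφ hb z m)
  obtain ⟨g', hg', hbd'⟩ := exists_integrable_bound hφ hb hz (exists_bound_score hφ z m b)
  have hc := continuous_mgfIntegrand hφ (m := m) (b := b) z
  have hs := continuous_score_scaleMap hφ (m := m) (b := b)
  have hs' := continuous_scoreSlope hφ (m := m) (b := b) ε
  have hm : ∀ δ, AEStronglyMeasurable
      (fun x => z * (score f m (scaleMap m b δ x) : ℝ) * mgfIntegrand f m b z δ x) volume :=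
    fun δ => Continuous.aestronglyMeasurable (by fun_prop)
  exact (hasDerivAt_integral_of_dominated_loc_of_deriv_le (abs_lt_half_mem_nhds hε)
    (Eventually.of_forall hm)
    (hg'.mono' (hm ε) (Eventually.of_forall fun x => hbd' ε hε x))
    (Continuous.aestronglyMeasurable (by fun_prop))
    (Eventually.of_forall fun x δ hδ => hbd δ hδ x) hg
    (Eventually.of_forall fun x δ hδ => hasDerivAt_score_mul_mgfIntegrand hφ z hδ x)).2

lemma scaleMap_zero (hb : 0 < b) (x : ℝ) : scaleMap m b 0 x = x := by
  simp [scaleMap, hb.ne']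

lemma mgfIntegrand_zero (hb : 0 < b) (z : ℂ) (x : ℝ) :
    mgfIntegrand f m b z 0 x = (exp (b * h f x) : ℝ) := by
  simp [mgfIntegrand, logRatio, scaleMap_zero hb]

lemma mgfInt_zero (hb : 0 < b) (z : ℂ) :
    mgfInt f m b z 0 = ((∫ x, exp (b * h f x) : ℝ) : ℂ) := by
  simp only [mgfInt, mgfIntegrand_zero hb]
  exact integral_ofReal

lemma mgfIntDeriv_zero (hb : 0 < b) (z : ℂ) :
    mgfIntDeriv f m b z 0 = z * ((∫ x, score f m x * exp (b * h f x) : ℝ) : ℂ) := by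
  simp only [mgfIntDeriv, mgfIntegrand_zero hb, scaleMap_zero hb, mul_assoc]
  rw [integral_const_mul, ← integral_complex_ofReal]
  simp

include hφ in
lemma hasDerivAt_mgfIntDeriv_zero (hb : 0 < b) {z : ℂ} (hz : z.re = 0 ∨ z.re = 1) :
    HasDerivAt (mgfIntDeriv f m b z)
      (z * ((∫ x, scoreSlope f m b 0 x * exp (b * h f x) : ℝ) : ℂ) +
        z ^ 2 * ((∫ x, score f m x ^ 2 * exp (b * h f x) : ℝ) : ℂ)) 0 := by
  refine (hasDerivAt_mgfIntDeriv hφ hb hz (by simpa using hb)).congr_deriv ?_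
  have hs := continuous_score hφ m
  have i1 : Integrable fun x => scoreSlope f m b 0 x * exp (b * h f x) := by
    have h1 := hφ.integrable_mul_exp ((continuous_r hφ m).sub (continuous_k hφ m))
      ((polyGrowth_r hφ m).sub (polyGrowth_k hφ m)) hb
    refine (h1.div_const (4 * (b + 0))).congr (Eventually.of_forall fun x => ?_)
    simp only [scoreSlope, scaleMap_zero hb, Pi.sub_apply]
    ring
  have i2 : Integrable fun x => score f m x ^ 2 * exp (b * h f x) :=
    hφ.integrable_mul_exp (hs.pow 2) ((polyGrowth_score hφ m).pow 2) hb
  rw [← integral_complex_ofReal, ← integral_complex_ofReal, ← integral_const_mul, ← integral_const_mul,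
    ← integral_add (i1.ofReal.const_mul _) (i2.ofReal.const_mul _)]
  congr 1
  ext x
  rw [mgfIntegrand_zero hb, scaleMap_zero hb]
  push_cast
  ring

variable (hpos : ∀ x, 0 < f x) (hf : Measurable f)

include hφ hpos hf in
lemma J_eq_integral (hb : 0 < b) :
    J f m b = (∫ x, score f m x ^ 2 * exp (b * h f x)) / (∫ x, exp (b * h f x)) -
      ((∫ x, score f m x * exp (b * h f x)) / ∫ x, exp (b * h f x)) ^ 2 := by
  have := isProbabilityMeasure_tempered_of_tame hpos hφ hb
  rw [J_eq_variance hpos hf hφ m hb, variance_eq_sub (memLp_two_tempered_of_polyGrowth hpos hf hφ hb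
    (continuous_score hφ m) (polyGrowth_score hφ m)), integral_tempered_of_tame hpos hf hφ hb,
    integral_tempered_of_tame hpos hf hφ hb]
  rfl

include hφ hpos hf in
/-- Second-order expansion of the one-dimensional characteristic function of the log ratio. -/
lemma tendsto_mgfInt_ratio (hb : 0 < b) {z₁ z₂ : ℂ} (h₁ : z₁.re = 0) (h₂ : z₁ + z₂ = 1) :
    Tendsto (fun ε : ℝ => (mgfInt f m b z₁ ε * mgfInt f m b z₂ ε /
      (mgfInt f m b 1 ε * mgfInt f m b 0 0) - 1) / (ε : ℂ) ^ 2) (𝓝[≠] 0)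
      (𝓝 (-(z₁ * z₂) * (J f m b : ℝ))) := by
  have hz₂ : z₂.re = 1 := by
    have := congrArg Complex.re h₂
    simpa [h₁] using this
  have r1 : z₁.re = 0 ∨ z₁.re = 1 := Or.inl h₁
  have r2 : z₂.re = 0 ∨ z₂.re = 1 := Or.inr hz₂
  have r3 : (1 : ℂ).re = 0 ∨ (1 : ℂ).re = 1 := Or.inr rfl
  have h0 : |(0 : ℝ)| < b / 2 := by simpa using hb
  set Z : ℝ := ∫ x, exp (b * h f x) with hZ
  set A : ℝ := ∫ x, score f m x * exp (b * h f x) with hA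
  set S : ℝ := ∫ x, score f m x ^ 2 * exp (b * h f x) with hS
  have hZ0 : (Z : ℂ) ≠ 0 := by exact_mod_cast (hφ.integral_exp_pos hb).ne'
  have hJ : J f m b = S / Z - (A / Z) ^ 2 := J_eq_integral hφ hpos hf hb
  have hN0 : ∀ z, mgfInt f m b z 0 = Z := mgfInt_zero hb
  have hN1 : ∀ z, mgfIntDeriv f m b z 0 = z * A := mgfIntDeriv_zero hb
  have hd := fun {z : ℂ} (hz : z.re = 0 ∨ z.re = 1) {ε : ℝ} (hε : |ε| < b / 2) =>
    hasDerivAt_mgfInt hφ (m := m) hb hz hε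
  have hd2 := fun {z : ℂ} (hz : z.re = 0 ∨ z.re = 1) =>
    hasDerivAt_mgfIntDeriv_zero hφ (m := m) hb hz
  -- Numerator minus denominator vanishes to first order because `z₁ + z₂ = 1`. At second order the
  -- `scoreSlope` terms, linear in `z`, cancel too, leaving `Z * S * (z₁² + z₂² - 1) + 2 * z₁ * z₂ *
  -- A² = -2 * z₁ * z₂ * (Z * S - A²)`, and `Z * S - A² = J * Z²`.
  have key := tendsto_div_sq_of_hasDerivAt
    (F := fun ε => mgfInt f m b z₁ ε * mgfInt f m b z₂ ε - mgfInt f m b 1 ε * Z)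
    (F' := fun ε => (mgfIntDeriv f m b z₁ ε * mgfInt f m b z₂ ε +
      mgfInt f m b z₁ ε * mgfIntDeriv f m b z₂ ε) - mgfIntDeriv f m b 1 ε * Z)
    (c := 2 * (-(z₁ * z₂) * (J f m b : ℝ)) * Z ^ 2) ?_ ?_ ?_ ?_
  · have hden : Tendsto (fun ε : ℝ => mgfInt f m b 1 ε * Z) (𝓝[≠] 0) (𝓝 ((Z : ℂ) * Z)) := by
      have := (hd r3 h0).continuousAt.tendsto
      rw [hN0] at this
      exact (this.mono_left nhdsWithin_le_nhds).mul_const _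
    have hne : ∀ᶠ ε : ℝ in 𝓝[≠] 0, mgfInt f m b 1 ε * Z ≠ 0 :=
      hden.eventually_ne (mul_ne_zero hZ0 hZ0)
    have hlim := key.div hden (mul_ne_zero hZ0 hZ0)
    have e : 2 * (-(z₁ * z₂) * (J f m b : ℝ)) * (Z : ℂ) ^ 2 / 2 / (Z * Z)
        = -(z₁ * z₂) * (J f m b : ℝ) := by
      field_simp
    rw [e] at hlim
    refine hlim.congr' ?_
    filter_upwards [hne, self_mem_nhdsWithin] with ε h1 h2
    have h2' : (ε : ℂ) ≠ 0 := by exact_mod_cast h2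
    simp only [Pi.div_apply, hN0]
    have h3 := left_ne_zero_of_mul h1
    field_simp
  · filter_upwards [abs_lt_half_mem_nhds h0] with ε hε
    exact ((hd r1 hε).fun_mul (hd r2 hε)).fun_sub ((hd r3 hε).mul_const _)
  · have e1 := ((((hd2 r1).fun_mul (hd r2 h0)).fun_add ((hd r1 h0).fun_mul (hd2 r2))).fun_sub
      ((hd2 r3).mul_const (Z : ℂ)))
    refine e1.congr_deriv ?_
    simp only [hN0, hN1, hJ]
    have hz : z₂ = 1 - z₁ := by linear_combination h₂
    rw [hz]
    push_cast
    field_simp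
    ring
  · simp only [hN0]; ring
  · simp only [hN0, hN1]
    linear_combination (A * Z : ℂ) * h₂

end Expansion

/-! ### The product law -/

lemma prodDensity_pos {f : ℝ → ℝ} (hpos : ∀ x, 0 < f x) (d : ℕ) (x : Fin d → ℝ) :
    0 < prodDensity f d x :=
  Finset.prod_pos fun _ _ => hpos _

lemma measurable_prodDensity {f : ℝ → ℝ} (hf : Measurable f) (d : ℕ) :
    Measurable (prodDensity f d) := by
  unfold prodDensity
  fun_prop

lemma prodDensity_rpow {f : ℝ → ℝ} (hpos : ∀ x, 0 < f x) (d : ℕ) (b : ℝ) (x : Fin d → ℝ) :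
    prodDensity f d x ^ b = ∏ i, exp (b * h f (x i)) := by
  rw [prodDensity, ← Real.finsetProd_rpow _ _ fun i _ => (hpos _).le]
  simp only [rpow_eq_exp_h hpos]

section Product

variable {f : ℝ → ℝ} (hpos : ∀ x, 0 < f x) (hf : Measurable f) (hφ : Tame (h f)) {b : ℝ}

include hpos hφ in
lemma integrable_prodDensity_rpow (d : ℕ) (hb : 0 < b) :
    Integrable fun x => prodDensity f d x ^ b := by
  simp only [prodDensity_rpow hpos]
  exact Integrable.fintype_prod (f := fun (_ : Fin d) x => exp (b * h f x))
    (μ := fun _ => volume) fun _ => hφ.integrable_exp hb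

include hpos in
lemma integral_prodDensity_rpow (d : ℕ) :
    ∫ x, prodDensity f d x ^ b = (∫ x, exp (b * h f x)) ^ d := by
  simp only [prodDensity_rpow hpos]
  rw [integral_fintype_prod_volume_eq_pow fun x => exp (b * h f x), Fintype.card_fin]

include hpos hφ in
lemma isProbabilityMeasure_tempered_prod (d : ℕ) (hb : 0 < b) :
    IsProbabilityMeasure (tempered (prodDensity f d) b) := by
  refine isProbabilityMeasure_tempered (prodDensity_pos hpos d)
    (integrable_prodDensity_rpow hpos hφ d hb) ?_
  rw [integral_prodDensity_rpow hpos]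
  exact pow_pos (hφ.integral_exp_pos hb) d

include hpos hf hφ in
lemma integral_prod_tempered_prod (d : ℕ) (hb : 0 < b) (u : ℝ → ℂ) :
    ∫ x, ∏ i, u (x i) ∂(tempered (prodDensity f d) b) =
      ((∫ x, u x * (exp (b * h f x) : ℝ)) / ((∫ x, exp (b * h f x) : ℝ) : ℂ)) ^ d := by
  rw [integral_tempered (prodDensity_pos hpos d) (measurable_prodDensity hf d)
    (integrable_prodDensity_rpow hpos hφ d hb), integral_prodDensity_rpow hpos]
  have e1 : ∀ x : Fin d → ℝ, prodDensity f d x ^ b • ∏ i, u (x i) =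
      ∏ i, u (x i) * (exp (b * h f (x i)) : ℝ) := fun x => by
    rw [prodDensity_rpow hpos, Complex.real_smul, Complex.ofReal_prod, ← Finset.prod_mul_distrib]
    exact Finset.prod_congr rfl fun i _ => mul_comm _ _
  simp only [e1]
  rw [integral_fintype_prod_volume_eq_pow fun x => u x * (exp (b * h f x) : ℝ), Fintype.card_fin,
    Complex.real_smul, div_pow, div_eq_inv_mul]
  push_cast
  rfl

include hpos hφ in
lemma isProbabilityMeasure_pairLaw (d : ℕ) {b' : ℝ} (hb : 0 < b) (hb' : 0 < b') :
    IsProbabilityMeasure (pairLaw f d b b') := by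
  have := isProbabilityMeasure_tempered_prod hpos hφ d hb
  have := isProbabilityMeasure_tempered_prod hpos hφ d hb'
  unfold pairLaw
  infer_instance

end Product

/-! ### The log acceptance ratio -/

/-- The one-dimensional contribution of the hot state to the log acceptance ratio. -/
def backRatio (f : ℝ → ℝ) (m b ε y : ℝ) : ℝ :=
  b * h f (√((b + ε) / b) * (y - m) + m) - (b + ε) * h f y

/-- The logarithm of the acceptance ratio. -/
def logAccept (f : ℝ → ℝ) (m b ε : ℝ) {d : ℕ} (z : (Fin d → ℝ) × (Fin d → ℝ)) : ℝ :=
  (∑ i, logRatio f m b ε (z.1 i)) + ∑ i, backRatio f m b ε (z.2 i)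

lemma acceptProb_eq {f : ℝ → ℝ} (hpos : ∀ x, 0 < f x) (m b ε : ℝ) {d : ℕ} (x y : Fin d → ℝ) :
    acceptProb f m b (b + ε) x y = min 1 (exp (logAccept f m b ε (x, y))) := by
  rw [acceptProb, logAccept]
  simp only [prodDensity_rpow hpos, ← Real.exp_sum, ← Real.exp_add, ← Real.exp_sub]
  congr 2
  simp only [logRatio, backRatio, scaleMap, rescale, Finset.sum_sub_distrib]
  ring

lemma acceptProb_nonneg {f : ℝ → ℝ} (hpos : ∀ x, 0 < f x) (m b ε : ℝ) {d : ℕ}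
    (x y : Fin d → ℝ) : 0 ≤ acceptProb f m b (b + ε) x y := by
  rw [acceptProb_eq hpos]
  positivity

/-- The atom at `b` contributes nothing, since the jump there is zero. -/
lemma integral_levelLaw {f : ℝ → ℝ} (hpos : ∀ x, 0 < f x) (m b ε : ℝ) {d : ℕ}
    (x y : Fin d → ℝ) : ∫ γ, (γ - b) ^ 2 ∂(levelLaw f m b (b + ε) x y) =
      ε ^ 2 * acceptProb f m b (b + ε) x y := by
  have hi : ∀ a c : ℝ, Integrable (fun γ : ℝ => (γ - b) ^ 2)
      (ENNReal.ofReal c • Measure.dirac a) := fun a c =>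
    (integrable_dirac (by simp)).smul_measure ENNReal.ofReal_ne_top
  rw [levelLaw, integral_add_measure (hi _ _) (hi _ _), integral_smul_measure,
    integral_smul_measure, integral_dirac, integral_dirac,
    ENNReal.toReal_ofReal (acceptProb_nonneg hpos m b ε x y)]
  simp
  ring

lemma ESJD_eq {f : ℝ → ℝ} (hpos : ∀ x, 0 < f x) (m b ε : ℝ) (d : ℕ) :
    ESJD f m d b ε = ε ^ 2 * acceptRate f m d b ε := by
  simp only [ESJD, acceptRate, integral_levelLaw hpos]
  rw [integral_const_mul]

section LogAccept

variable {f : ℝ → ℝ} (hpos : ∀ x, 0 < f x) (hf : Measurable f) (hφ : Tame (h f)) {m b ε : ℝ}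

include hφ in
lemma continuous_logAccept {d : ℕ} :
    Continuous (logAccept f m b ε : (Fin d → ℝ) × (Fin d → ℝ) → ℝ) := by
  have h1 := continuous_logRatio hφ (m := m) (b := b) ε
  have h2 := hφ.contDiff.continuous
  unfold logAccept backRatio
  fun_prop

lemma integral_eq_mul_integral_scaleMap (hb : 0 < b) (hbε : 0 < b + ε) (u : ℝ → ℂ) :
    ∫ y, u y = (√(b / (b + ε)) : ℝ) * ∫ x, u (scaleMap m b ε x) := by
  have hs : 0 < √(b / (b + ε)) := Real.sqrt_pos.2 (div_pos hb hbε)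
  have e1 := Measure.integral_comp_mul_left (fun y => u (y + m)) (√(b / (b + ε)))
  have e2 := integral_sub_right_eq_self (μ := volume) (fun x => u (√(b / (b + ε)) * x + m)) m
  simp only [scaleMap]
  rw [e2, e1, integral_add_right_eq_self (μ := volume) u m, abs_of_pos (inv_pos.2 hs),
    Complex.real_smul, ← mul_assoc, ← Complex.ofReal_mul, mul_inv_cancel₀ hs.ne']
  simp

/-- The two rescalings are mutually inverse, so the hot term at a scaled point undoes the cold one.
Together with the tilting identity below, this writes hot expectations as `mgfInt` at `1 - t`. -/
lemma backRatio_scaleMap (hb : 0 < b) (hbε : 0 < b + ε) (x : ℝ) :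
    backRatio f m b ε (scaleMap m b ε x) = -logRatio f m b ε x := by
  have e1 : √((b + ε) / b) * (scaleMap m b ε x - m) + m = x := by
    rw [scaleMap, add_sub_cancel_right, ← mul_assoc, ← Real.sqrt_mul (by positivity),
      div_mul_div_cancel₀ hb.ne', div_self hbε.ne']
    simp
  rw [backRatio, e1, logRatio]
  ring

lemma mgfIntegrand_one_sub (t : ℂ) (x : ℝ) :
    mgfIntegrand f m b (1 - t) ε x =
      Complex.exp (-(t * logRatio f m b ε x)) * (exp ((b + ε) * h f (scaleMap m b ε x)) : ℝ) := by
  rw [mgfIntegrand, Complex.ofReal_exp, Complex.ofReal_exp, ← Complex.exp_add, ← Complex.exp_add]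
  congr 1
  rw [logRatio]
  push_cast
  ring

include hpos hf hφ in
-- Independence of the states and of their coordinates gives a `d`-th power. The cold factor is
-- `N(it) / N(0)`. The hot one becomes `N(1 - it) / N(1)` after the change of variables, whose
-- Jacobian cancels in the quotient.
lemma charFun_map_logAccept (hb : 0 < b) (hbε : 0 < b + ε) (d : ℕ) (t : ℝ) :
    charFun ((pairLaw f d b (b + ε)).map (logAccept f m b ε)) t =
      (mgfInt f m b (t * Complex.I) ε * mgfInt f m b (1 - t * Complex.I) ε /
        (mgfInt f m b 1 ε * mgfInt f m b 0 0)) ^ d := by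
  have := isProbabilityMeasure_tempered_prod hpos hφ d hb
  have := isProbabilityMeasure_tempered_prod hpos hφ d hbε
  rw [charFun_apply_real, integral_map (continuous_logAccept hφ).aemeasurable
    (Continuous.aestronglyMeasurable (by fun_prop))]
  have e1 : ∀ z : (Fin d → ℝ) × (Fin d → ℝ), Complex.exp (t * logAccept f m b ε z * Complex.I) =
      (∏ i, Complex.exp (t * Complex.I * logRatio f m b ε (z.1 i))) *
        ∏ i, Complex.exp (t * Complex.I * backRatio f m b ε (z.2 i)) := fun z => by
    rw [← Complex.exp_sum, ← Complex.exp_sum, ← Complex.exp_add, ← Finset.mul_sum,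
      ← Finset.mul_sum, logAccept]
    congr 1
    push_cast
    ring
  simp only [e1]
  rw [pairLaw, integral_prod_mul
    (fun x : Fin d → ℝ => ∏ i, Complex.exp (t * Complex.I * logRatio f m b ε (x i)))
    (fun y : Fin d → ℝ => ∏ i, Complex.exp (t * Complex.I * backRatio f m b ε (y i))),
    integral_prod_tempered_prod hpos hf hφ d hb
      (fun x => Complex.exp (t * Complex.I * logRatio f m b ε x)),
    integral_prod_tempered_prod hpos hf hφ d hbε
      (fun y => Complex.exp (t * Complex.I * backRatio f m b ε y)), ← mul_pow]
  congr 1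
  have hs : ((√(b / (b + ε)) : ℝ) : ℂ) ≠ 0 := by
    exact_mod_cast (Real.sqrt_pos.2 (div_pos hb hbε)).ne'
  have e2 : ((∫ y, exp ((b + ε) * h f y) : ℝ) : ℂ) =
      (√(b / (b + ε)) : ℝ) * mgfInt f m b 1 ε := by
    rw [← integral_complex_ofReal, integral_eq_mul_integral_scaleMap (m := m) hb hbε, mgfInt]
    congr 2
    ext x
    have := mgfIntegrand_one_sub (f := f) (m := m) (b := b) (ε := ε) 0 x
    simpa using this.symm
  have e3 : ∫ y, Complex.exp (t * Complex.I * backRatio f m b ε y) * (exp ((b + ε) * h f y) : ℝ) =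
      (√(b / (b + ε)) : ℝ) * mgfInt f m b (1 - t * Complex.I) ε := by
    rw [integral_eq_mul_integral_scaleMap (m := m) hb hbε, mgfInt]
    congr 2
    ext x
    rw [backRatio_scaleMap hb hbε, mgfIntegrand_one_sub]
    push_cast
    ring_nf
  have e4 : ∫ x, Complex.exp (t * Complex.I * logRatio f m b ε x) * (exp (b * h f x) : ℝ) =
      mgfInt f m b (t * Complex.I) ε := rfl
  rw [e2, e3, e4, ← mgfInt_zero (m := m) hb 0, div_mul_div_comm, mul_left_comm,
    mul_left_comm (mgfInt f m b 0 0), mul_div_mul_left _ _ hs, mul_comm (mgfInt f m b 0 0)]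

include hpos hf hφ in
lemma tendsto_charFun_logAccept (hb : 0 < b) {ℓ : ℝ} (hℓ : 0 < ℓ) (t : ℝ) :
    Tendsto (fun d : ℕ => charFun ((pairLaw f d b (b + ℓ / √d)).map (logAccept f m b (ℓ / √d))) t)
      atTop (𝓝 (Complex.exp (-(ℓ ^ 2 * J f m b : ℝ) * (t * Complex.I + t ^ 2)))) := by
  -- At `d = 0` the quotient is `0` by convention, so `b + ℓ / √d` is positive for every `d`.
  have hε : ∀ d : ℕ, 0 ≤ ℓ / √(d : ℝ) := fun d => by positivity
  have hε0 : Tendsto (fun d : ℕ => ℓ / √(d : ℝ)) atTop (𝓝[≠] 0) := by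
    refine tendsto_nhdsWithin_iff.2 ⟨?_, ?_⟩
    · exact tendsto_const_nhds.div_atTop
        (Real.tendsto_sqrt_atTop.comp tendsto_natCast_atTop_atTop)
    · filter_upwards [eventually_gt_atTop 0] with d hd
      have : (0 : ℝ) < d := by exact_mod_cast hd
      exact (div_pos hℓ (Real.sqrt_pos.2 this)).ne'
  have key := (tendsto_mgfInt_ratio hφ hpos hf (m := m) hb (z₁ := t * Complex.I)
    (z₂ := 1 - t * Complex.I) (by simp) (by ring)).comp hε0
  have key2 := key.const_mul ((ℓ : ℂ) ^ 2)
  have hlim : (ℓ : ℂ) ^ 2 * (-(t * Complex.I * (1 - t * Complex.I)) * (J f m b : ℝ)) =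
      -(ℓ ^ 2 * J f m b : ℝ) * (t * Complex.I + t ^ 2) := by
    push_cast
    linear_combination ((ℓ : ℂ) ^ 2 * t ^ 2 * (J f m b : ℝ)) * Complex.I_sq
  rw [hlim] at key2
  -- As `ε ^ 2 = ℓ ^ 2 / d`, the expansion says that `d` times (ratio minus one) converges, hence
  -- the `d`-th power converges to an exponential.
  refine (Complex.tendsto_one_add_pow_exp_of_tendsto (g := fun d : ℕ =>
    mgfInt f m b (t * Complex.I) (ℓ / √d) * mgfInt f m b (1 - t * Complex.I) (ℓ / √d) /
      (mgfInt f m b 1 (ℓ / √d) * mgfInt f m b 0 0) - 1) (key2.congr' ?_)).congr fun d => ?_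
  · filter_upwards [eventually_gt_atTop 0] with d hd
    have hd' : (0 : ℝ) < d := by exact_mod_cast hd
    have e1 : (((ℓ / √(d : ℝ) : ℝ) : ℂ)) ^ 2 = (ℓ : ℂ) ^ 2 / d := by
      rw [← Complex.ofReal_pow, div_pow, Real.sq_sqrt hd'.le]
      push_cast
      rfl
    have hd2 : (d : ℂ) ≠ 0 := by exact_mod_cast hd.ne'
    have hℓ2 : (ℓ : ℂ) ≠ 0 := by exact_mod_cast hℓ.ne'
    simp only [Function.comp_apply, e1]
    field_simp
  · rw [charFun_map_logAccept hpos hf hφ hb (by linarith [hε d])]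
    congr 1
    ring

include hpos hf hφ in
/-- The acceptance rate of the swap converges for spacings of order `d ^ (-1/2)`. -/
lemma tendsto_acceptRate (hb : 0 < b) {ℓ : ℝ} (hℓ : 0 < ℓ) :
    Tendsto (fun d : ℕ => acceptRate f m d b (ℓ / √d)) atTop
      (𝓝 (2 * Phi (-(ℓ * √(J f m b)) / √2))) := by
  have hJ : 0 ≤ J f m b := by
    rw [J_eq_variance hpos hf hφ m hb]
    exact variance_nonneg _ _
  have hε : ∀ d : ℕ, 0 ≤ ℓ / √(d : ℝ) := fun d => by positivity
  -- Matching `exp (-ℓ² J (it + t²))` with a normal characteristic function forces variance `s ^ 2 =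
  -- 2 * ℓ ^ 2 * J` and mean `-s ^ 2 / 2`. The case `s = 0` is a Dirac mass and is allowed.
  set s : ℝ := √2 * (ℓ * √(J f m b)) with hs
  have hs0 : 0 ≤ s := by positivity
  have hs2 : s ^ 2 = 2 * (ℓ ^ 2 * J f m b) := by
    rw [hs, mul_pow, mul_pow, Real.sq_sqrt zero_le_two, Real.sq_sqrt hJ]
  have hP : ∀ d : ℕ, IsProbabilityMeasure
      ((pairLaw f d b (b + ℓ / √d)).map (logAccept f m b (ℓ / √d))) := fun d => by
    have := isProbabilityMeasure_pairLaw hpos hφ d hb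
      (b' := b + ℓ / √d) (by linarith [hε d])
    exact Measure.isProbabilityMeasure_map (continuous_logAccept hφ).aemeasurable
  let ν : ℕ → ProbabilityMeasure ℝ := fun d => ⟨_, hP d⟩
  let G : ProbabilityMeasure ℝ :=
    ⟨gaussianReal (-(s ^ 2 / 2)) (s ^ 2).toNNReal, inferInstance⟩
  have hweak : Tendsto ν atTop (𝓝 G) := by
    refine ProbabilityMeasure.tendsto_iff_tendsto_charFun.2 fun t => ?_
    have h1 := tendsto_charFun_logAccept hpos hf hφ (m := m) hb hℓ t
    simp only [ν, G, ProbabilityMeasure.coe_mk]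
    rw [charFun_gaussianReal, Real.coe_toNNReal _ (sq_nonneg s), hs2]
    convert h1 using 2
    congr 1
    push_cast
    ring
  have hbdd : ∀ x : ℝ, ‖min 1 (exp x)‖ ≤ 1 := fun x => by
    rw [Real.norm_eq_abs, abs_of_nonneg (by positivity)]
    exact min_le_left _ _
  have hlim := ProbabilityMeasure.tendsto_iff_forall_integral_tendsto.1 hweak
    (BoundedContinuousFunction.ofNormedAddCommGroup (fun x : ℝ => min 1 (exp x)) (by fun_prop) 1
      hbdd)
  simp only [ν, G, ProbabilityMeasure.coe_mk, BoundedContinuousFunction.coe_ofNormedAddCommGroup] at hlim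
  rw [integral_min_one_exp_gaussianReal s hs0] at hlim
  have hs3 : -(s / 2) = -(ℓ * √(J f m b)) / √2 := by
    rw [hs]
    have : √(2 : ℝ) * √2 = 2 := Real.mul_self_sqrt zero_le_two
    field_simp
    linear_combination (-√(J f m b)) * this
  rw [hs3] at hlim
  refine hlim.congr fun d => ?_
  rw [integral_map (continuous_logAccept hφ).aemeasurable
    (Continuous.aestronglyMeasurable (by fun_prop))]
  simp only [acceptRate, acceptProb_eq hpos]

end LogAccept

end QuanTA

end

/-! ### Assembly of the theorem -/

theorem theorem1 (f H : ℝ → ℝ) (m : ℝ)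
    (hfH : ∀ x, f x = Real.exp (-H x))
    (hsmooth : ContDiff ℝ 4 f)
    (hunimodal : QuanTA.IsUnimodalAt f m)
    (hregular : QuanTA.IsRegularlyVarying H)
    (hfourth : ∃ M : ℝ, 0 < M ∧ ∀ z, |iteratedDeriv 4 (fun x => Real.log (f x)) z| < M)
    (β : ℝ) (hβ : 0 < β) :
    -- the tempered marginal law and the moments that enter `V`, `I`, `R` are well defined
    (IsProbabilityMeasure (QuanTA.tempered f β) ∧
      MemLp (QuanTA.h f) 2 (QuanTA.tempered f β) ∧
      MemLp (QuanTA.k f m) 2 (QuanTA.tempered f β) ∧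
      Integrable (QuanTA.r f m) (QuanTA.tempered f β)) ∧
    QuanTA.V f m β = 1 / β ^ 2 ∧
    0 ≤ QuanTA.J f m β ∧
    -- limiting efficiency for spacings `ε = ℓ / √d`
    (∀ ℓ : ℝ, 0 < ℓ →
      Tendsto (fun d : ℕ => (d : ℝ) * QuanTA.ESJD f m d β (ℓ / √(d : ℝ))) atTop
        (𝓝 (QuanTA.limitEff f m β ℓ))) ∧
    -- the limit has exactly one maximiser in the non-degenerate case, and none otherwise
    (0 < QuanTA.J f m β →
      ∃! ℓ : ℝ, 0 < ℓ ∧ IsMaxOn (QuanTA.limitEff f m β) (Ioi 0) ℓ) ∧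
    (QuanTA.J f m β = 0 →
      ¬ ∃ ℓ : ℝ, 0 < ℓ ∧ IsMaxOn (QuanTA.limitEff f m β) (Ioi 0) ℓ) ∧
    -- at the optimal `ℓ` the limiting swap acceptance rate is 0.234 to three significant figures
    (∀ ℓ : ℝ, 0 < ℓ → IsMaxOn (QuanTA.limitEff f m β) (Ioi 0) ℓ →
      ∃ a : ℝ,
        Tendsto (fun d : ℕ => QuanTA.acceptRate f m d β (ℓ / √(d : ℝ))) atTop (𝓝 a) ∧
        0.2335 ≤ a ∧ a < 0.2345) := by
  have hpos : ∀ x, 0 < f x := fun x => by rw [hfH]; positivity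
  have hf : Measurable f := hsmooth.continuous.measurable
  have hφ : QuanTA.Tame (QuanTA.h f) :=
    QuanTA.tame_log hfH hsmooth hunimodal hregular hfourth
  have hrate := fun {ℓ : ℝ} (hℓ : 0 < ℓ) =>
    QuanTA.tendsto_acceptRate hpos hf hφ (m := m) hβ hℓ
  refine ⟨⟨QuanTA.isProbabilityMeasure_tempered_of_tame hpos hφ hβ,
    QuanTA.memLp_two_tempered_of_polyGrowth hpos hf hφ hβ hφ.contDiff.continuous hφ.growth,
    QuanTA.memLp_two_tempered_of_polyGrowth hpos hf hφ hβ (QuanTA.continuous_k hφ m)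
      (QuanTA.polyGrowth_k hφ m),
    QuanTA.integrable_tempered_of_polyGrowth hpos hf hφ hβ (QuanTA.continuous_r hφ m)
      (QuanTA.polyGrowth_r hφ m)⟩,
    QuanTA.V_eq hpos hf hφ m hβ, ?_, fun ℓ hℓ => ?_, fun hJ => ?_,
    QuanTA.not_isMaxOn_limitEff_of_J_eq_zero, fun ℓ hℓ hmax => ⟨_, hrate hℓ, ?_⟩⟩
  · rw [QuanTA.J_eq_variance hpos hf hφ m hβ]
    exact variance_nonneg _ _
  · have h1 := (hrate hℓ).const_mul (ℓ ^ 2)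
    have h2 : ℓ ^ 2 * (2 * QuanTA.Phi (-(ℓ * √(QuanTA.J f m β)) / √2)) =
        QuanTA.limitEff f m β ℓ := by
      rw [QuanTA.limitEff]
      ring
    rw [h2] at h1
    refine h1.congr' ?_
    -- The identity `d * (ℓ / √d) ^ 2 = ℓ ^ 2` fails at `d = 0`.
    filter_upwards [eventually_gt_atTop 0] with d hd
    have hd' : (0 : ℝ) < d := by exact_mod_cast hd
    rw [QuanTA.ESJD_eq hpos, div_pow, Real.sq_sqrt hd'.le, ← mul_assoc,
      mul_div_cancel₀ _ hd'.ne']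
  · obtain ⟨ℓ₀, h0, hm, huniq, -⟩ := QuanTA.exists_maximiser_limitEff hJ
    exact ⟨ℓ₀, ⟨h0, hm⟩, fun ℓ hℓ => huniq ℓ hℓ.1 hℓ.2⟩
  · have hJ : 0 < QuanTA.J f m β := by
      refine lt_of_le_of_ne ?_ fun hJ =>
        QuanTA.not_isMaxOn_limitEff_of_J_eq_zero hJ.symm ⟨ℓ, hℓ, hmax⟩
      rw [QuanTA.J_eq_variance hpos hf hφ m hβ]
      exact variance_nonneg _ _
    obtain ⟨ℓ₀, -, -, huniq, hbounds⟩ := QuanTA.exists_maximiser_limitEff hJ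
    rwa [huniq ℓ hℓ hmax]
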